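/- There is an absolute constant $c > 0$ such that for every integer $h \ge 2$ there is $\varepsilon_0 = \varepsilon_0(h) > 0$ with the following property. For every $0 < \varepsilon < \varepsilon_0$ there is $n_0 = n_0(h, \varepsilon)$ such that for all integers $n > n_0$: if $A$ is a set of $n$ real numbers whose product set $A.A = \{ab : a, b \in A\}$ satisfies $$|A.A| \le n^{1+\varepsilon},$$ then the $h$-fold sumset $h(A.A) = \{x_1 + \cdots + x_h : x_1, \dots, x_h \in A.A\}$ satisfies $$|h(A.A)| > n^{c\,(h/\log h)^{1/3}}.$$ -/

import Mathlib

open scoped Pointwise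

/-- The `h`-fold sumset `S + S + ⋯ + S` (`h` summands) of a finite set `S`: the set of all sums
`s₁ + ⋯ + s_h` with every `s_i` in `S` (repetitions allowed). -/
def hFoldSumset {M : Type*} [AddCommMonoid M] [DecidableEq M] (h : ℕ) (S : Finset M) : Finset M :=
  (Fintype.piFinset fun _ : Fin h => S).image fun s => ∑ i, s i

/-! Fixing a popular product `y` and taking logarithms replaces `A` by a set `L` with few sums such
that `y * exp u` lies in `A * A` for every `u ∈ L - L` (`exists_log_set`). Many different sums of
such exponentials are needed.

If `L` meets at least `|L| ^ (1/4)` cells of a fixed length `R`, it contains a large lacunary set,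
and the sums of `q` of its exponentials are distinct (`choose_le_card_hFoldSumset`). Otherwise
`exists_separated_progressions` gives a set `Y` of at least `n ^ (1/5)` points and one small `τ`
with `u + i * τ ∈ L - L` for all `u ∈ Y`, `i ≤ N`. If the power sums of two families of frequencies
first differ in degree `o`, the difference `Q o` of the exponential sums has order `|τ| ^ o`
(`exists_expSum_bounds`). As `Y` is separated at a large multiple of `|τ|`, the sums of `exp (w o) *
Q o` over `o ∈ O`, with `w o ∈ Y`, behave like digit expansions and are distinct
(`injOn_digit_sum`). Up to dilation each is a difference of two sums of at most `k ^ 3 ≤ h` elements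
of `A * A`, so `|Y| ^ |O| ≤ |h(A.A)| ^ 2`.

What remains is to attain many orders `o` with only `k ^ 2` terms (`exists_powerSum_orders`). A
`p`-adic construction gives at least `p ^ (k ^ 2 * (k - 1) / 2)` families determined by their power
sums of degree at most `k`. The degrees in `O` already determine them, and each such power sum is
below `p ^ (2 * k ^ 2 + 1)`; hence `|O|` is at least `(k - 1) / 6`. The resulting exponent is of
order `h ^ (1/3)`, without the logarithm. -/

/-! ### Power sums modulo prime powers, and orders of vanishing -/

/-- The power-sum differences are a matrix applied to `x - y`. Modulo `p` its entries are `(j + 1) *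
i ^ j`, a Vandermonde matrix with scaled rows, so `k < p` makes the determinant prime to `p`. -/
theorem dvd_sub_of_dvd_powerSum_sub {k p : ℕ} (hp : p.Prime) (hkp : k < p) (n : ℕ)
    (x y : Fin k → ℤ) (hx : ∀ i, (p : ℤ) ∣ x i - (i : ℕ)) (hy : ∀ i, (p : ℤ) ∣ y i - (i : ℕ))
    (h : ∀ j : Fin k, (p : ℤ) ^ n ∣ ∑ i, x i ^ (j + 1 : ℕ) - ∑ i, y i ^ (j + 1 : ℕ)) (i : Fin k) :
    (p : ℤ) ^ n ∣ x i - y i := by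
  have : Fact p.Prime := ⟨hp⟩
  set M : Matrix (Fin k) (Fin k) ℤ :=
    Matrix.of fun j i => ∑ a ∈ Finset.range (j + 1), x i ^ a * y i ^ ((j : ℕ) - a) with hM
  have hMd : ∀ j, (M.mulVec (x - y)) j = ∑ i, x i ^ (j + 1 : ℕ) - ∑ i, y i ^ (j + 1 : ℕ) := by
    intro j
    rw [Matrix.mulVec, dotProduct, ← Finset.sum_sub_distrib]
    refine Finset.sum_congr rfl fun i _ => ?_
    simp only [hM, Matrix.of_apply, Pi.sub_apply]
    rw [← geom_sum₂_mul]
    simp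
  have hcast : ∀ (z : Fin k → ℤ), (∀ i, (p : ℤ) ∣ z i - (i : ℕ)) →
      ∀ i, ((z i : ℤ) : ZMod p) = ((i : ℕ) : ZMod p) := by
    intro z hz i
    have := (ZMod.intCast_zmod_eq_zero_iff_dvd (z i - (i : ℕ)) p).2 (hz i)
    push_cast at this
    exact sub_eq_zero.1 this
  have hdet : ((M.det : ℤ) : ZMod p) ≠ 0 := by
    have h1 : ((M.det : ℤ) : ZMod p) = (M.map (Int.castRingHom (ZMod p))).det := by
      rw [← RingHom.mapMatrix_apply, ← RingHom.map_det]; rfl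
    have h2 : M.map (Int.castRingHom (ZMod p)) = Matrix.of fun (j : Fin k) (i : Fin k) =>
        (((j : ℕ) + 1 : ℕ) : ZMod p) *
          (Matrix.vandermonde fun i : Fin k => ((i : ℕ) : ZMod p)).transpose j i := by
      ext j i
      simp only [hM, Matrix.map_apply, Matrix.of_apply, eq_intCast, Matrix.transpose_apply,
        Matrix.vandermonde_apply]
      push_cast
      rw [hcast x hx, hcast y hy]
      rw [Finset.sum_congr rfl (g := fun _ => ((i : ℕ) : ZMod p) ^ (j : ℕ))]
      · simp
      · intro a ha
        rw [← pow_add, Nat.add_sub_cancel' (by simpa [Nat.lt_succ_iff] using ha)]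
    rw [h1, h2, Matrix.det_mul_column, Matrix.det_transpose]
    refine mul_ne_zero (Finset.prod_ne_zero_iff.2 fun j _ => ?_) ?_
    · rw [Ne, ZMod.natCast_eq_zero_iff]
      intro hd
      have := Nat.le_of_dvd (by omega) hd
      omega
    · rw [Matrix.det_vandermonde_ne_zero_iff]
      intro a b hab
      have hab' : ((a : ℕ) : ZMod p) = ((b : ℕ) : ZMod p) := hab
      rw [ZMod.natCast_eq_natCast_iff] at hab'
      exact Fin.ext (Nat.ModEq.eq_of_lt_of_lt hab' (by omega) (by omega))
  have hcop : IsCoprime ((p : ℤ) ^ n) M.det := by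
    refine IsCoprime.pow_left ((Nat.prime_iff_prime_int.1 hp).irreducible.coprime_iff_not_dvd.2 ?_)
    rwa [← ZMod.intCast_zmod_eq_zero_iff_dvd]
  refine hcop.dvd_of_dvd_mul_left ?_
  have hadj : M.det * (x i - y i) = ∑ j, M.adjugate i j * (M.mulVec (x - y)) j := by
    have : (M.adjugate.mulVec (M.mulVec (x - y))) i = M.det * (x i - y i) := by
      rw [Matrix.mulVec_mulVec, Matrix.adjugate_mul, Matrix.smul_mulVec, Matrix.one_mulVec]
      simp
    rw [← this]; rfl
  rw [hadj]
  refine Finset.dvd_sum fun j _ => Dvd.dvd.mul_left ?_ _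
  rw [hMd]; exact h j

/-- Many `k`-tuples told apart by their power sums of degree `j` modulo `p ^ j`, `1 ≤ j ≤ k`. -/
theorem exists_powerSum_modEq_separated {k p : ℕ} (hp : p.Prime) (hkp : k < p) :
    ∃ Z : Finset (Fin k → ℕ), p ^ (∑ j : Fin k, (j : ℕ)) ≤ Z.card ∧ (∀ x ∈ Z, ∀ i, x i < p ^ k) ∧
      ∀ x ∈ Z, ∀ y ∈ Z,
        (∀ j : Fin k, ∑ i, x i ^ (j + 1 : ℕ) ≡ ∑ i, y i ^ (j + 1 : ℕ) [MOD p ^ (j + 1 : ℕ)]) →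
          x = y := by
  rcases Nat.eq_zero_or_pos k with rfl | hk
  · exact ⟨{default}, by simp, by simp, fun x _ y _ _ => Subsingleton.elim _ _⟩
  have hp0 := hp.pos
  set D : Finset (Fin k → ℕ) :=
    (Fintype.piFinset fun _ : Fin k => Finset.range (p ^ (k - 1))).image
      fun z i => (i : ℕ) + p * z i with hD
  have hDcard : D.card = p ^ (k * (k - 1)) := by
    rw [hD, Finset.card_image_of_injective, Fintype.card_piFinset]
    · simp [← pow_mul, mul_comm]
    · intro z w hzw
      funext i
      have := congrFun hzw i
      simpa [hp0.ne'] using this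
  have hDlt : ∀ x ∈ D, ∀ i, x i < p ^ k := by
    intro x hx i
    obtain ⟨z, hz, rfl⟩ := Finset.mem_image.1 hx
    have hzi : z i < p ^ (k - 1) := by simpa using Fintype.mem_piFinset.1 hz i
    have : p ^ k = p * p ^ (k - 1) := by rw [← pow_succ']; congr 1; omega
    have h3 : p * (z i + 1) ≤ p * p ^ (k - 1) := Nat.mul_le_mul_left _ hzi
    have := i.2
    simp only
    rw [mul_add] at h3
    omega
  have hDmod : ∀ x ∈ D, ∀ i, (p : ℤ) ∣ (x i : ℤ) - (i : ℕ) := by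
    intro x hx i
    obtain ⟨z, hz, rfl⟩ := Finset.mem_image.1 hx
    push_cast
    simp
  set φ : (Fin k → ℕ) → Fin k → ℕ := fun x j => (∑ i, x i ^ (j + 1 : ℕ)) % p ^ (j + 1 : ℕ) with hφ
  -- A residue modulo `p ^ (j + 1)` has `p ^ (k - 1 - j)` lifts modulo `p ^ k`. `W` records all
  -- these lifts; its size is the square root of that of `D`, so passing to the coarser moduli keeps
  -- at least the square root.
  set W : Finset (Fin k → ℕ) := Fintype.piFinset fun j : Fin k => Finset.range (p ^ (k - 1 - j))
  have hWcard : W.card = p ^ (∑ j : Fin k, (j : ℕ)) := by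
    rw [Fintype.card_piFinset]
    simp only [Finset.card_range]
    rw [Finset.prod_pow_eq_pow_sum]
    congr 1
    rw [← Equiv.sum_comp Fin.revPerm (fun j : Fin k => (j : ℕ))]
    refine Finset.sum_congr rfl fun j _ => ?_
    simp only [Fin.revPerm_apply, Fin.val_rev]
    omega
  have hle : D.card ≤ (D.image φ ×ˢ W).card := by
    refine Finset.card_le_card_of_injOn
      (fun x => (φ x, fun j => (∑ i, x i ^ (j + 1 : ℕ)) % p ^ k / p ^ (j + 1 : ℕ))) ?_ ?_
    · intro x hx
      rw [Finset.mem_coe, Finset.mem_product]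
      refine ⟨Finset.mem_image_of_mem _ hx, Fintype.mem_piFinset.2 fun j => ?_⟩
      rw [Finset.mem_range, Nat.div_lt_iff_lt_mul (pow_pos hp0 _), ← pow_add]
      have : k - 1 - (j : ℕ) + (j + 1) = k := by omega
      rw [this]
      exact Nat.mod_lt _ (pow_pos hp0 _)
    · intro x hx y hy hxy
      simp only [Prod.mk.injEq] at hxy
      have key : ∀ j : Fin k, (∑ i, x i ^ (j + 1 : ℕ)) ≡ (∑ i, y i ^ (j + 1 : ℕ)) [MOD p ^ k] := by
        intro j
        have h1 := congrFun hxy.1 j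
        have h2 := congrFun hxy.2 j
        simp only [hφ] at h1 h2
        have hdvd : p ^ (j + 1 : ℕ) ∣ p ^ k := pow_dvd_pow _ (by omega)
        rw [← Nat.mod_mod_of_dvd _ hdvd, ← Nat.mod_mod_of_dvd (∑ i, y i ^ (j + 1 : ℕ)) hdvd] at h1
        rw [Nat.ModEq, ← Nat.mod_add_div ((∑ i, x i ^ (j + 1 : ℕ)) % p ^ k) (p ^ (j + 1 : ℕ)),
          h1, h2, Nat.mod_add_div]
      funext i
      have := dvd_sub_of_dvd_powerSum_sub hp hkp k (fun i => (x i : ℤ)) (fun i => (y i : ℤ))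
        (hDmod x hx) (hDmod y hy) (fun j => by
          have := (Nat.modEq_iff_dvd.1 (key j).symm)
          push_cast at this
          exact this) i
      have h3 : y i ≡ x i [MOD p ^ k] := Nat.modEq_iff_dvd.2 (by push_cast; exact this)
      exact (Nat.ModEq.eq_of_lt_of_lt h3 (hDlt y hy i) (hDlt x hx i)).symm
  obtain ⟨Z, hZD, hZinj, hZim⟩ := Finset.exists_subset_injOn_image_eq_of_surjOn D (D.image φ)
    (f := φ) (by simp [Set.SurjOn])
  refine ⟨Z, ?_, fun x hx => hDlt x (hZD hx), fun x hx y hy hxy => hZinj hx hy (funext hxy)⟩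
  have hZc : Z.card = (D.image φ).card := by
    rw [← hZim, Finset.card_image_of_injOn hZinj]
  rw [Finset.card_product, hDcard, hWcard, ← hZc] at hle
  have hsum : k * (k - 1) = (∑ j : Fin k, (j : ℕ)) + ∑ j : Fin k, (j : ℕ) := by
    have := Finset.sum_range_id_mul_two k
    rw [← Fin.sum_univ_eq_sum_range (fun i => i)] at this
    omega
  rw [hsum, pow_add] at hle
  exact Nat.le_of_mul_le_mul_right hle (pow_pos hp0 _)

/-- The factors `p ^ b` allow the blocks to be recovered in turn: once the earlier blocks agree,
modulo `p ^ ((b + 1) * (j + 1))` only block `b` remains, which gives its power sum modulo `p ^ (j +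
1)`. -/
theorem eq_of_scaled_powerSum_eq {k p : ℕ} (hp : p.Prime) {Z : Finset (Fin k → ℕ)}
    (hZ : ∀ x ∈ Z, ∀ y ∈ Z,
      (∀ j : Fin k, ∑ i, x i ^ (j + 1 : ℕ) ≡ ∑ i, y i ^ (j + 1 : ℕ) [MOD p ^ (j + 1 : ℕ)]) → x = y)
    {v w : Fin k → Fin k → ℕ} (hv : ∀ b, v b ∈ Z) (hw : ∀ b, w b ∈ Z)
    (h : ∀ j : Fin k, ∑ q : Fin k × Fin k, (p ^ (q.1 : ℕ) * v q.1 q.2) ^ (j + 1 : ℕ) =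
      ∑ q : Fin k × Fin k, (p ^ (q.1 : ℕ) * w q.1 q.2) ^ (j + 1 : ℕ)) : v = w := by
  have main : ∀ n : ℕ, ∀ b : Fin k, (b : ℕ) = n → v b = w b := by
    intro n
    induction n using Nat.strong_induction_on with
    | _ n ih =>
      intro b hb
      refine hZ _ (hv b) _ (hw b) fun j => ?_
      set d : Fin k → ℤ := fun c => ∑ i, (v c i : ℤ) ^ (j + 1 : ℕ) - ∑ i, (w c i : ℤ) ^ (j + 1 : ℕ)
        with hd
      have hsum : ∑ c : Fin k, (p : ℤ) ^ ((c : ℕ) * (j + 1)) * d c = 0 := by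
        have := congrArg (Nat.cast : ℕ → ℤ) (h j)
        push_cast at this
        rw [Fintype.sum_prod_type, Fintype.sum_prod_type, ← sub_eq_zero,
          ← Finset.sum_sub_distrib] at this
        rw [← this]
        refine Finset.sum_congr rfl fun c _ => ?_
        simp only [hd, mul_sub, Finset.mul_sum, mul_pow, ← pow_mul]
      have hdvd : (p : ℤ) ^ (((b : ℕ) + 1) * (j + 1)) ∣ (p : ℤ) ^ ((b : ℕ) * (j + 1)) * d b := by
        rw [← Finset.add_sum_erase _ _ (Finset.mem_univ b)] at hsum
        rw [eq_neg_of_add_eq_zero_left hsum, dvd_neg]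
        refine Finset.dvd_sum fun c hc => ?_
        have hcb : c ≠ b := (Finset.mem_erase.1 hc).1
        rcases lt_or_gt_of_ne (fun hh : (c : ℕ) = b => hcb (Fin.ext hh)) with hlt | hgt
        · have : d c = 0 := by simp only [hd, ih c (hb ▸ hlt) c rfl, sub_self]
          simp [this]
        · exact Dvd.dvd.mul_right (pow_dvd_pow _ (Nat.mul_le_mul_right _ hgt)) _
      rw [add_mul, pow_add, one_mul] at hdvd
      have hp0 : (p : ℤ) ≠ 0 := by exact_mod_cast hp.ne_zero
      have h2 := (mul_dvd_mul_iff_left (pow_ne_zero _ hp0)).1 hdvd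
      refine (Nat.modEq_iff_dvd.2 ?_).symm
      push_cast
      exact h2
  funext b
  exact main b b rfl

/-- A substitute for the exact Tarry–Escott problem: with `k ^ 2` terms on each side, at least
`(k - 1) / 6` different orders `o ≤ k` of vanishing are attained. -/
theorem exists_powerSum_orders (k : ℕ) :
    ∃ N : ℕ, ∃ O : Finset ℕ, O ⊆ Finset.Icc 1 k ∧ k ≤ 6 * O.card + 1 ∧
      ∀ o ∈ O, ∃ e f : Fin k × Fin k → ℕ, (∀ q, e q ≤ N) ∧ (∀ q, f q ≤ N) ∧
        (∀ j < o, ∑ q, e q ^ j = ∑ q, f q ^ j) ∧ ∑ q, e q ^ o ≠ ∑ q, f q ^ o := by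
  classical
  -- With `p > k ^ 2`, summing `k ^ 2` terms costs only one extra factor `p`.
  obtain ⟨p, hpk, hp⟩ := Nat.exists_infinite_primes (k ^ 2 + k + 1)
  obtain ⟨Z, hZcard, hZlt, hZ⟩ := exists_powerSum_modEq_separated (k := k) hp (by nlinarith)
  have hp1 := hp.one_lt
  set E : Finset (Fin k → Fin k → ℕ) := Fintype.piFinset fun _ => Z with hE
  have hEcard : p ^ ((∑ j : Fin k, (j : ℕ)) * k) ≤ E.card := by
    rw [hE, Fintype.card_piFinset, pow_mul]
    simpa using Nat.pow_le_pow_left hZcard k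
  set enc : (Fin k → Fin k → ℕ) → Fin k × Fin k → ℕ := fun w q => p ^ (q.1 : ℕ) * w q.1 q.2
    with henc
  set P : (Fin k → Fin k → ℕ) → ℕ → ℕ := fun w j => ∑ q, enc w q ^ j with hP
  have hEmem : ∀ w ∈ E, ∀ b, w b ∈ Z := fun w hw b => Fintype.mem_piFinset.1 hw b
  have henc_le : ∀ w ∈ E, ∀ q, enc w q ≤ p ^ (2 * k) := by
    intro w hw q
    have h1 := (hZlt _ (hEmem w hw q.1) q.2).le
    calc enc w q ≤ p ^ (q.1 : ℕ) * p ^ k := Nat.mul_le_mul_left _ h1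
      _ = p ^ ((q.1 : ℕ) + k) := (pow_add _ _ _).symm
      _ ≤ p ^ (2 * k) := Nat.pow_le_pow_right hp.pos (by omega)
  set O : Finset ℕ := (Finset.Icc 1 k).filter fun o =>
    ∃ v ∈ E, ∃ w ∈ E, (∀ j < o, P v j = P w j) ∧ P v o ≠ P w o with hO
  refine ⟨p ^ (2 * k), O, Finset.filter_subset _ _, ?_, ?_⟩
  · have hcard : E.card ≤ (Fintype.piFinset fun _ : O => Finset.range (p ^ (2 * k ^ 2 + 1))).card := by
      refine Finset.card_le_card_of_injOn (fun w o => P w o) ?_ ?_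
      · intro w hw
        refine Fintype.mem_piFinset.2 fun o => Finset.mem_range.2 ?_
        have ho : (o : ℕ) ≤ k := (Finset.mem_Icc.1 (Finset.mem_filter.1 o.2).1).2
        have h1 : P w o ≤ ∑ _q : Fin k × Fin k, p ^ (2 * k ^ 2) := by
          refine Finset.sum_le_sum fun q _ => ?_
          calc enc w q ^ (o : ℕ) ≤ (p ^ (2 * k)) ^ (o : ℕ) := Nat.pow_le_pow_left (henc_le w hw q) _
            _ ≤ (p ^ (2 * k)) ^ k := Nat.pow_le_pow_right (pow_pos hp.pos _) ho
            _ = p ^ (2 * k ^ 2) := by rw [← pow_mul]; ring_nf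
        simp only [Finset.sum_const, Finset.card_univ, Fintype.card_prod, Fintype.card_fin,
          smul_eq_mul] at h1
        have h2 : k * k < p := by nlinarith
        calc P w o ≤ _ := h1
          _ < p * p ^ (2 * k ^ 2) := Nat.mul_lt_mul_of_pos_right h2 (pow_pos hp.pos _)
          _ = _ := (pow_succ' p (2 * k ^ 2)).symm
      · intro v hv w hw hvw
        have hvw' : ∀ o ∈ O, P v o = P w o := fun o ho => congrFun hvw ⟨o, ho⟩
        refine eq_of_scaled_powerSum_eq hp hZ (hEmem v hv) (hEmem w hw) fun j => ?_
        -- The least degree of disagreement would itself be an element of `O`, where the sums agree.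
        have hall : ∀ n : ℕ, n ≤ k → P v n = P w n := by
          intro n
          induction n using Nat.strong_induction_on with
          | _ n ih =>
            intro hn
            by_contra hne
            have hn0 : n ≠ 0 := by
              rintro rfl
              simp [hP] at hne
            exact hne (hvw' n (Finset.mem_filter.2 ⟨Finset.mem_Icc.2 ⟨by omega, hn⟩, v, hv, w, hw,
              fun j hj => ih j hj (by omega), hne⟩))
        exact hall (j + 1) j.2
    rw [Fintype.card_piFinset (fun _ : O => Finset.range (p ^ (2 * k ^ 2 + 1)))] at hcard
    simp only [Finset.card_range, Finset.prod_const, Finset.card_univ, Fintype.card_coe] at hcard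
    rw [← pow_mul] at hcard
    -- Exponents of `p` give `k ^ 2 * (k - 1) / 2 ≤ (2 * k ^ 2 + 1) * |O|`; the rest uses `2 * k ^ 2
    -- + 1 ≤ 3 * k ^ 2`.
    have h3 := (Nat.pow_le_pow_iff_right hp1).1 (hEcard.trans hcard)
    have hsum : k * (k - 1) = (∑ j : Fin k, (j : ℕ)) * 2 := by
      rw [← Finset.sum_range_id_mul_two k, ← Fin.sum_univ_eq_sum_range (fun i => i)]
    rcases Nat.eq_zero_or_pos k with rfl | hk
    · omega
    obtain ⟨l, rfl⟩ : ∃ l, k = l + 1 := ⟨k - 1, by omega⟩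
    simp only [Nat.add_sub_cancel] at hsum
    by_contra hcon
    push Not at hcon
    have h4 : O.card * 6 + 1 ≤ l := by omega
    have h5 : (2 * (l + 1) ^ 2 + 1) * O.card * 2 ≤ (l + 1) ^ 2 * (O.card * 6) := by
      nlinarith [Nat.mul_le_mul_right O.card (Nat.one_le_pow 2 (l + 1) (by omega))]
    have h6 := Nat.mul_le_mul_left ((l + 1) ^ 2) h4
    have h7 : (l + 1) ^ 2 * l = (∑ j : Fin (l + 1), (j : ℕ)) * (l + 1) * 2 := by
      rw [mul_right_comm, ← hsum]; ring
    have h8 : 0 < (l + 1) ^ 2 := by positivity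
    nlinarith
  · intro o ho
    obtain ⟨-, v, hv, w, hw, hj, hne⟩ := Finset.mem_filter.1 ho
    exact ⟨enc v, enc w, henc_le v hv, henc_le w hw, hj, hne⟩

/-! ### Counting cells under small doubling -/

/-- The number of cells `[z * r, (z + 1) * r)`, `z` an integer, that meet `L`. -/
noncomputable def numCells (r : ℝ) (L : Finset ℝ) : ℕ := (L.image fun u => ⌊u / r⌋).card

theorem floor_div_sub_le {r : ℝ} (hr : 0 < r) {w : ℕ} {a b : ℝ} (h : a - b < w * r) :
    ⌊a / r⌋ - ⌊b / r⌋ ≤ w := by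
  have h1 : a / r ≤ b / r + (w : ℕ) := by
    rw [div_add' _ _ _ hr.ne']
    exact div_le_div_of_nonneg_right (by linarith) hr.le
  have := Int.floor_mono h1
  rw [Int.floor_add_natCast] at this
  omega

theorem exists_subset_injOn_floor (r : ℝ) (L : Finset ℝ) :
    ∃ T ⊆ L, T.card = numCells r L ∧ Set.InjOn (fun u => ⌊u / r⌋) (T : Set ℝ) := by
  obtain ⟨T, hTL, hTinj, hTim⟩ := Finset.exists_subset_injOn_image_eq_of_surjOn (L : Set ℝ)
    (L.image fun u => ⌊u / r⌋) (f := fun u => ⌊u / r⌋) (by simp [Set.SurjOn])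
  exact ⟨T, by exact_mod_cast hTL, by rw [numCells, ← hTim, Finset.card_image_of_injOn hTinj], hTinj⟩

theorem numCells_mono (r : ℝ) {X L : Finset ℝ} (h : X ⊆ L) : numCells r X ≤ numCells r L :=
  Finset.card_le_card (Finset.image_subset_image h)

/-- Keep one point of `L` per cell. For a fixed sum, the summand from `L` varies by less than `w *
r`, hence over at most `w + 1` cells. -/
theorem card_mul_numCells_le {r : ℝ} (hr : 0 < r) (w : ℕ) (U L : Finset ℝ)
    (hU : ∀ u ∈ U, ∀ v ∈ U, u - v < w * r) :
    U.card * numCells r L ≤ (w + 1) * (U + L).card := by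
  classical
  obtain ⟨T, hTL, hTcard, hTinj⟩ := exists_subset_injOn_floor r L
  rw [← hTcard, ← Finset.card_product]
  refine Finset.card_le_mul_card_image_of_maps_to (f := fun q : ℝ × ℝ => q.1 + q.2) ?_ (w + 1) ?_
  · intro q hq
    have := Finset.mem_product.1 hq
    exact Finset.add_mem_add this.1 (hTL this.2)
  · intro v _
    set F := (U ×ˢ T).filter fun q : ℝ × ℝ => q.1 + q.2 = v with hF
    have hFm : ∀ q ∈ F, q.1 ∈ U ∧ q.2 ∈ T ∧ q.1 + q.2 = v := by
      intro q hq
      simpa [hF, and_assoc] using hq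
    rcases F.eq_empty_or_nonempty with h0 | hne
    · simp [h0]
    obtain ⟨q₀, hq₀, hmin⟩ := Finset.exists_min_image F (fun q => ⌊q.2 / r⌋) hne
    calc F.card ≤ (Finset.Icc ⌊q₀.2 / r⌋ (⌊q₀.2 / r⌋ + w)).card := by
          refine Finset.card_le_card_of_injOn (fun q => ⌊q.2 / r⌋) ?_ ?_
          · intro q hq
            have h1 := hFm q hq
            have h2 := hFm q₀ hq₀
            refine Finset.mem_coe.2 (Finset.mem_Icc.2 ⟨hmin q hq, ?_⟩)
            have h3 := floor_div_sub_le hr (w := w) (a := q.2) (b := q₀.2)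
              (by linarith [hU _ h2.1 _ h1.1, h1.2.2, h2.2.2])
            linarith
          · intro q hq q' hq' hqq
            have h1 := hFm q hq
            have h2 := hFm q' hq'
            have h3 := hTinj h1.2.1 h2.2.1 hqq
            exact Prod.ext (by linarith [h1.2.2, h2.2.2]) h3
      _ = w + 1 := by rw [Int.card_Icc]; omega

theorem card_three_sub_two_le {L : Finset ℝ} {K : ℝ} (hL : L.Nonempty)
    (hK : ((L + L).card : ℝ) ≤ K * L.card) :
    ((L + L + L - (L + L)).card : ℝ) ≤ K ^ 5 * L.card := by
  have h := Finset.pluennecke_ruzsa_inequality_nsmul_sub_nsmul_add hL L 3 2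
  have e : L + L + L - (L + L) = 3 • L - 2 • L := by
    rw [succ_nsmul, two_nsmul]
  rw [← e] at h
  have h' : ((L + L + L - (L + L)).card : ℝ) ≤ (((L + L).card : ℝ) / L.card) ^ 5 * L.card := by
    have h2 := (NNRat.cast_le (K := ℝ)).2 h
    push_cast at h2
    exact h2
  have hpos : (0 : ℝ) < L.card := by exact_mod_cast hL.card_pos
  refine h'.trans (mul_le_mul_of_nonneg_right (pow_le_pow_left₀ (by positivity) ?_ 5) hpos.le)
  rwa [div_le_iff₀ hpos]

theorem numCells_half_le {r : ℝ} (hr : 0 < r) (L : Finset ℝ) :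
    numCells (r / 2) L ≤ 2 * numCells r L := by
  classical
  rw [numCells, numCells, mul_comm]
  have : L.image (fun u => ⌊u / (r / 2)⌋) ⊆ (L.image fun u => ⌊u / r⌋).biUnion
      fun z => {2 * z, 2 * z + 1} := by
    intro z hz
    obtain ⟨u, hu, rfl⟩ := Finset.mem_image.1 hz
    refine Finset.mem_biUnion.2 ⟨⌊u / r⌋, Finset.mem_image_of_mem _ hu, ?_⟩
    have e : u / (r / 2) = 2 * (u / r) := by field_simp
    have h1 := Int.floor_le (u / r)
    have h2 := Int.lt_floor_add_one (u / r)
    have h3 : 2 * ⌊u / r⌋ ≤ ⌊u / (r / 2)⌋ := Int.le_floor.2 (by push_cast; rw [e]; linarith)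
    have h4 : ⌊u / (r / 2)⌋ < 2 * ⌊u / r⌋ + 2 := Int.floor_lt.2 (by push_cast; rw [e]; linarith)
    simp only [Finset.mem_insert, Finset.mem_singleton]
    omega
  exact (Finset.card_le_card this).trans
    (Finset.card_biUnion_le_card_mul _ _ _ fun z _ => Finset.card_le_two)

/-- Halving the length at most doubles the number of cells, so the first halving that reaches `t`
stays below `2 * t`. -/
theorem exists_scale {L : Finset ℝ} {R t : ℝ} (hR : 0 < R) (h1 : numCells R L < t)
    (h2 : t ≤ L.card) :
    ∃ r, 0 < r ∧ r ≤ R ∧ t ≤ numCells r L ∧ (numCells r L : ℝ) < 2 * t := by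
  classical
  have hlim : Filter.Tendsto (fun i : ℕ => R / 2 ^ i) Filter.atTop (nhds 0) := by
    have := (tendsto_pow_atTop_nhds_zero_of_lt_one (r := (1 / 2 : ℝ)) (by norm_num)
      (by norm_num)).const_mul R
    simpa [div_eq_mul_inv] using this
  have hev : ∀ᶠ i : ℕ in Filter.atTop, ∀ q ∈ L.offDiag, R / 2 ^ i < |q.1 - q.2| := by
    rw [Filter.eventually_all_finset]
    intro q hq
    exact hlim.eventually_lt_const (abs_pos.2 (sub_ne_zero.2 (Finset.mem_offDiag.1 hq).2.2))
  obtain ⟨i₀, hi₀⟩ := hev.exists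
  have hex : ∃ i : ℕ, t ≤ numCells (R / 2 ^ i) L := by
    refine ⟨i₀, ?_⟩
    rw [numCells, Finset.card_image_of_injOn]
    · exact h2
    · intro u hu v hv huv
      by_contra hne
      have h3 := Int.abs_sub_lt_one_of_floor_eq_floor huv
      have h4 := hi₀ (u, v) (Finset.mem_offDiag.2 ⟨hu, hv, hne⟩)
      have hpos : 0 < R / 2 ^ i₀ := by positivity
      rw [← sub_div, abs_div, abs_of_pos hpos, div_lt_one hpos] at h3
      exact lt_asymm h3 h4
  have hspec := Nat.find_spec hex
  have hmin := fun {j} => Nat.find_min hex (m := j)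
  set i := Nat.find hex
  refine ⟨R / 2 ^ i, by positivity, div_le_self hR.le (one_le_pow₀ (by norm_num)), hspec, ?_⟩
  have hi : i ≠ 0 := by
    intro h0
    rw [h0] at hspec
    simp only [pow_zero, div_one] at hspec
    linarith
  obtain ⟨j, hj⟩ := Nat.exists_eq_succ_of_ne_zero hi
  have h3 := hmin (j := j) (by omega)
  have h4 := numCells_half_le (r := R / 2 ^ j) (by positivity) L
  rw [hj, Nat.succ_eq_add_one, pow_succ, ← div_div]
  have h5 : (numCells (R / 2 ^ j / 2) L : ℝ) ≤ 2 * numCells (R / 2 ^ j) L := by exact_mod_cast h4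
  push Not at h3
  linarith

/-- Adding `L` to the part of `X` in one cell shows that no cell holds more than `2 * K * |L| /
numCells r L` points. A large subset therefore meets proportionally many cells. -/
theorem card_mul_numCells_le_of_subset {L X : Finset ℝ} {K r : ℝ} (hr : 0 < r)
    (hK : ((L + L).card : ℝ) ≤ K * L.card) (hX : X ⊆ L) :
    (X.card : ℝ) * numCells r L ≤ numCells r X * (2 * K * L.card) := by
  classical
  have hsum : (X.card : ℝ) = ∑ z ∈ X.image (fun u => ⌊u / r⌋),
      ((X.filter fun u => ⌊u / r⌋ = z).card : ℝ) := by
    exact_mod_cast Finset.card_eq_sum_card_image (fun u => ⌊u / r⌋) X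
  rw [hsum, Finset.sum_mul, numCells, ← nsmul_eq_mul]
  refine Finset.sum_le_card_nsmul _ _ _ fun z _ => ?_
  have h := card_mul_numCells_le hr 1 (X.filter fun u => ⌊u / r⌋ = z) L (by
    intro u hu v hv
    have huv : ⌊u / r⌋ = ⌊v / r⌋ :=
      (Finset.mem_filter.1 hu).2.trans (Finset.mem_filter.1 hv).2.symm
    have h3 := (abs_lt.1 (Int.abs_sub_lt_one_of_floor_eq_floor huv)).2
    rw [← sub_div, div_lt_one hr] at h3
    simpa using h3)
  have h2 : ((X.filter fun u => ⌊u / r⌋ = z) + L).card ≤ (L + L).card :=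
    Finset.card_le_card (Finset.add_subset_add_right ((Finset.filter_subset _ _).trans hX))
  have h3 : (((X.filter fun u => ⌊u / r⌋ = z).card * numCells r L : ℕ) : ℝ) ≤ 2 * (L + L).card := by
    exact_mod_cast h.trans (Nat.mul_le_mul_left _ h2)
  push_cast at h3
  exact h3.trans (by linarith)

/-- Keep one point per `r`-cell and apply pigeonhole to the pair (`R`-cell, index of the `r`-cell
modulo `G`): distinct indices with equal residues differ by at least `G`. -/
theorem exists_separated_subset {X : Finset ℝ} {r R : ℝ} (hr : 0 < r) (hR : 0 < R) {G : ℕ}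
    (hG : 0 < G) :
    ∃ Y ⊆ X, numCells r X ≤ numCells R X * G * Y.card ∧ (∀ u ∈ Y, ∀ v ∈ Y, u - v < R) ∧
      ∀ u ∈ Y, ∀ v ∈ Y, u ≠ v → (G - 1) * r < |u - v| := by
  classical
  rcases X.eq_empty_or_nonempty with rfl | hne
  · exact ⟨∅, by simp, by simp [numCells], by simp, by simp⟩
  obtain ⟨T, hTX, hTcard, hTinj⟩ := exists_subset_injOn_floor r X
  set B := (X.image fun u => ⌊u / R⌋) ×ˢ (Finset.Ico (0 : ℤ) G) with hB
  have hBcard : B.card = numCells R X * G := by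
    rw [hB, Finset.card_product, numCells]; simp
  have hBne : B.Nonempty := (hne.image _).product ⟨0, by simp [hG]⟩
  obtain ⟨y, -, hy⟩ := Finset.exists_le_card_fiber_of_nsmul_le_card_of_maps_to
    (s := T) (t := B) (f := fun u => (⌊u / R⌋, ⌊u / r⌋ % G)) (b := (T.card : ℚ) / B.card)
    (by
      intro u hu
      refine Finset.mem_product.2 ⟨Finset.mem_image_of_mem _ (hTX hu), Finset.mem_Ico.2 ⟨?_, ?_⟩⟩
      · exact Int.emod_nonneg _ (by omega)
      · exact Int.emod_lt_of_pos _ (by omega)) hBne (by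
      have : (B.card : ℚ) ≠ 0 := by exact_mod_cast hBne.card_pos.ne'
      rw [nsmul_eq_mul, mul_div_cancel₀ _ this])
  set Y := T.filter fun u => (⌊u / R⌋, ⌊u / r⌋ % (G : ℤ)) = y with hY
  have hYm : ∀ u ∈ Y, u ∈ T ∧ ⌊u / R⌋ = y.1 ∧ ⌊u / r⌋ % (G : ℤ) = y.2 := by
    intro u hu
    have := Finset.mem_filter.1 hu
    exact ⟨this.1, congrArg Prod.fst this.2, congrArg Prod.snd this.2⟩
  refine ⟨Y, (Finset.filter_subset _ _).trans hTX, ?_, ?_, ?_⟩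
  · rw [← hBcard, ← hTcard]
    rw [div_le_iff₀ (by exact_mod_cast hBne.card_pos)] at hy
    rw [mul_comm]
    exact_mod_cast hy
  · intro u hu v hv
    have huv := (hYm u hu).2.1.trans (hYm v hv).2.1.symm
    have h3 := (abs_lt.1 (Int.abs_sub_lt_one_of_floor_eq_floor huv)).2
    rwa [← sub_div, div_lt_one hR] at h3
  · have key : ∀ u ∈ Y, ∀ v ∈ Y, ⌊u / r⌋ < ⌊v / r⌋ → (G - 1) * r < v - u := by
      intro u hu v hv hlt
      have hmod := (hYm u hu).2.2.trans (hYm v hv).2.2.symm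
      have h1 : (G : ℤ) ≤ ⌊v / r⌋ - ⌊u / r⌋ :=
        Int.le_of_dvd (by omega) (Int.ModEq.dvd hmod)
      have h2 : (G : ℝ) ≤ ⌊v / r⌋ - ⌊u / r⌋ := by exact_mod_cast h1
      have h3 := Int.floor_le (v / r)
      have h4 := Int.lt_floor_add_one (u / r)
      have h5 : (G : ℝ) - 1 < (v - u) / r := by rw [sub_div]; linarith
      rwa [lt_div_iff₀ hr] at h5
    intro u hu v hv huv
    have hne' : ⌊u / r⌋ ≠ ⌊v / r⌋ := fun h => huv (hTinj (hYm u hu).1 (hYm v hv).1 h)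
    rcases lt_or_gt_of_ne hne' with h | h
    · exact (key u hu v hv h).trans_le (by rw [abs_sub_comm]; exact le_abs_self _)
    · exact (key v hv u hu h).trans_le (le_abs_self _)

/-! ### Progressions in the difference set -/

theorem eq_of_second_differences_eq {M : ℕ} {t s : Fin (M + 2) → ℝ}
    (h : ∀ i : ℕ, ∀ hi : i < M,
      t ⟨i + 2, by omega⟩ - 2 * t ⟨i + 1, by omega⟩ + t ⟨i, by omega⟩ =
        s ⟨i + 2, by omega⟩ - 2 * s ⟨i + 1, by omega⟩ + s ⟨i, by omega⟩)
    (i : ℕ) (hi : i < M + 2) :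
    t ⟨i, hi⟩ = s ⟨i, hi⟩ + (t 0 - s 0) + i * ((t 1 - t 0) - (s 1 - s 0)) := by
  have key : ∀ i : ℕ, ∀ hi : i + 1 < M + 2,
      t ⟨i, by omega⟩ = s ⟨i, by omega⟩ + (t 0 - s 0) + i * ((t 1 - t 0) - (s 1 - s 0)) ∧
      t ⟨i + 1, hi⟩ = s ⟨i + 1, hi⟩ + (t 0 - s 0) +
        ((i + 1 : ℕ) : ℝ) * ((t 1 - t 0) - (s 1 - s 0)) := by
    intro i
    induction i with
    | zero =>
      intro hi
      have e0 : (⟨0, by omega⟩ : Fin (M + 2)) = 0 := rfl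
      have e1 : (⟨0 + 1, hi⟩ : Fin (M + 2)) = 1 := rfl
      rw [e0, e1]
      push_cast
      constructor <;> ring
    | succ j ih =>
      intro hi
      have h1 := ih (by omega)
      have h2 := h j (by omega)
      refine ⟨h1.2, ?_⟩
      have h3 : t ⟨j + 1 + 1, hi⟩ = s ⟨j + 2, hi⟩ - 2 * s ⟨j + 1, by omega⟩ + s ⟨j, by omega⟩
          + 2 * t ⟨j + 1, by omega⟩ - t ⟨j, by omega⟩ := by linarith
      rw [h3, h1.1, h1.2]
      push_cast
      ring
  rcases i with _ | i
  · exact (key 0 (by omega)).1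
  · exact (key i hi).2

/-- Tuples from `L` with all entries in a common cell. -/
noncomputable def cellTuples (r : ℝ) (L : Finset ℝ) (n : ℕ) : Finset (Fin (n + 1) → ℝ) :=
  open Classical in
  (Fintype.piFinset fun _ : Fin (n + 1) => L).filter fun t => ∀ i, ⌊t i / r⌋ = ⌊t 0 / r⌋

/-- The power mean inequality applied to the cell populations. -/
theorem card_pow_le_card_cellTuples (r : ℝ) (L : Finset ℝ) (n : ℕ) :
    (L.card : ℝ) ^ (n + 1) ≤ (numCells r L : ℝ) ^ n * (cellTuples r L n).card := by
  classical
  set I := L.image fun u => ⌊u / r⌋ with hI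
  set f : ℤ → ℕ := fun z => (L.filter fun u => ⌊u / r⌋ = z).card with hf
  have h1 : L.card = ∑ z ∈ I, f z := Finset.card_eq_sum_card_image _ L
  have h2 : ∑ z ∈ I, f z ^ (n + 1) ≤ (cellTuples r L n).card := by
    rw [Finset.card_eq_sum_card_fiberwise (f := fun t => ⌊t 0 / r⌋) (t := I)]
    · refine Finset.sum_le_sum fun z _ => ?_
      have : f z ^ (n + 1) =
          (Fintype.piFinset fun _ : Fin (n + 1) => L.filter fun u => ⌊u / r⌋ = z).card := by
        simp [Fintype.card_piFinset, hf]
      rw [this]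
      refine Finset.card_le_card fun t ht => ?_
      have ht' := fun i => Finset.mem_filter.1 (Fintype.mem_piFinset.1 ht i)
      refine Finset.mem_filter.2 ⟨Finset.mem_filter.2
        ⟨Fintype.mem_piFinset.2 fun i => (ht' i).1, fun i => ?_⟩, (ht' 0).2⟩
      rw [(ht' i).2, (ht' 0).2]
    · intro t ht
      exact Finset.mem_image_of_mem _ (Fintype.mem_piFinset.1 (Finset.mem_filter.1 ht).1 0)
  have h3 := pow_sum_div_card_le_sum_pow (s := I) (f := fun z => (f z : ℝ)) (by simp) n
  have h4 : (∑ z ∈ I, (f z : ℝ) ^ (n + 1)) ≤ (cellTuples r L n).card := by exact_mod_cast h2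
  have h5 : (∑ z ∈ I, (f z : ℝ)) = L.card := by rw [h1]; push_cast; rfl
  rw [h5] at h3
  rcases Nat.eq_zero_or_pos I.card with h0 | hpos
  · have : L.card = 0 := by
      rw [Finset.card_eq_zero, Finset.image_eq_empty] at h0
      simp [h0]
    rw [this]
    simp only [Nat.cast_zero, ne_eq, Nat.succ_ne_zero, not_false_eq_true, zero_pow]
    positivity
  · rw [div_le_iff₀ (by positivity)] at h3
    calc _ ≤ _ := h3
      _ ≤ (cellTuples r L n).card * (I.card : ℝ) ^ n :=
        mul_le_mul_of_nonneg_right h4 (by positivity)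
      _ = _ := mul_comm _ _

theorem exists_card_fiber_mul_ge {α β : Type*} [DecidableEq β] {s : Finset α} {t : Finset β}
    {f : α → β} (hf : ∀ a ∈ s, f a ∈ t) (ht : t.Nonempty) :
    ∃ y ∈ t, s.card ≤ (s.filter fun a => f a = y).card * t.card := by
  have h0 : (t.card : ℚ) ≠ 0 := by exact_mod_cast ht.card_pos.ne'
  obtain ⟨y, hyt, hy⟩ := Finset.exists_le_card_fiber_of_nsmul_le_card_of_maps_to
    (b := (s.card : ℚ) / t.card) hf ht (by rw [nsmul_eq_mul, mul_div_cancel₀ _ h0])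
  rw [div_le_iff₀ (by exact_mod_cast ht.card_pos)] at hy
  exact ⟨y, hyt, by exact_mod_cast hy⟩

/-- Bookkeeping for the two pigeonholes below: `m` points, `J` cells, `t` tuples sharing second
differences, `u` possible differences, `v` tuples sharing a slope. The number of cells cancels. -/
theorem le_of_sq_le_chain {m J D t u v : ℝ} {M : ℕ} (hm : 0 < m) (hJ : 0 < J) (hD : 0 < D)
    (hv : 0 ≤ v) (h1 : m ^ 2 ≤ t * (J * D ^ M)) (h2 : t ≤ 2 * (v * u)) (h3 : u * J ≤ D * m) :
    m ≤ 2 * D ^ (M + 1) * v := by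
  have h4 : m * m ≤ m * (2 * D ^ (M + 1) * v) := by
    calc m * m = m ^ 2 := by ring
      _ ≤ t * (J * D ^ M) := h1
      _ ≤ (2 * (v * u)) * (J * D ^ M) := by gcongr
      _ = 2 * v * D ^ M * (u * J) := by ring
      _ ≤ 2 * v * D ^ M * (D * m) := by gcongr
      _ = _ := by ring
  exact le_of_mul_le_mul_left h4 hm

set_option maxHeartbeats 1000000 in
/-- Many arithmetic progressions with a common small difference in the difference set of a set
with small doubling, following Croot, Ruzsa and Schoen. -/
theorem exists_many_progressions {L : Finset ℝ} {K r : ℝ} (M : ℕ) (hL : L.Nonempty) (hK1 : 1 ≤ K)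
    (hK : ((L + L).card : ℝ) ≤ K * L.card) (hr : 0 < r)
    (hsmall : 2 * numCells r L * (5 * K ^ 5) ^ M ≤ L.card) :
    ∃ τ c : ℝ, ∃ X ⊆ L, τ ≠ 0 ∧ |τ| < 2 * r ∧ (L.card : ℝ) ≤ 2 * (5 * K ^ 5) ^ (M + 1) * X.card ∧
      ∀ u ∈ X, ∀ i : ℕ, i < M + 2 → u - c + i * τ ∈ L - L := by
  classical
  set D : ℝ := 5 * K ^ 5 with hD
  have hDpos : 0 < D := by positivity
  set m : ℝ := (L.card : ℝ) with hm
  have hmpos : 0 < m := Nat.cast_pos.2 hL.card_pos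
  set J : ℝ := (numCells r L : ℝ) with hJ
  have hJpos : 0 < J := Nat.cast_pos.2 (hL.image _).card_pos
  -- `U` holds all second differences of the tuples and all differences of their first steps. Since
  -- its diameter is below `4 * r` and `U + L ⊆ 3L - 2L`, Plünnecke gives `|U| ≤ D * m / J`; this is
  -- the origin of `5 * K ^ 5`.
  set U : Finset ℝ := ((L + L) - (L + L)).filter fun u => |u| < 2 * r with hU
  have hUne : U.Nonempty := by
    obtain ⟨a, ha⟩ := hL
    refine ⟨0, Finset.mem_filter.2 ⟨?_, by simpa using hr⟩⟩
    exact Finset.mem_sub.2 ⟨a + a, Finset.add_mem_add ha ha, a + a, Finset.add_mem_add ha ha,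
      sub_self _⟩
  have hUpos : (0 : ℝ) < U.card := by exact_mod_cast hUne.card_pos
  have hUJ : U.card * J ≤ D * m := by
    have h1 := card_mul_numCells_le hr 4 U L (by
      intro u hu v hv
      have h1 := (abs_lt.1 (Finset.mem_filter.1 hu).2)
      have h2 := (abs_lt.1 (Finset.mem_filter.1 hv).2)
      push_cast
      linarith)
    have h2 : U + L ⊆ L + L + L - (L + L) := by
      intro z hz
      obtain ⟨u, hu, l, hl, rfl⟩ := Finset.mem_add.1 hz
      obtain ⟨a, ha, b, hb, rfl⟩ := Finset.mem_sub.1 (Finset.mem_filter.1 hu).1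
      exact Finset.mem_sub.2 ⟨a + l, Finset.add_mem_add ha hl, b, hb, by ring⟩
    have h3 : ((U.card * numCells r L : ℕ) : ℝ) ≤ 5 * (L + L + L - (L + L)).card := by
      exact_mod_cast h1.trans (Nat.mul_le_mul_left _ (Finset.card_le_card h2))
    push_cast at h3
    calc U.card * J ≤ _ := h3
      _ ≤ 5 * (K ^ 5 * L.card) := by
        gcongr
        exact card_three_sub_two_le hL hK
      _ = D * m := by rw [hD, hm]; ring
  set T := cellTuples r L (M + 1) with hT
  have hTmem : ∀ t ∈ T, (∀ i, t i ∈ L) ∧ ∀ i j, |t i - t j| < r := by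
    intro t ht
    have h1 := Finset.mem_filter.1 ht
    refine ⟨Fintype.mem_piFinset.1 h1.1, fun i j => ?_⟩
    have h3 := Int.abs_sub_lt_one_of_floor_eq_floor ((h1.2 i).trans (h1.2 j).symm)
    rwa [← sub_div, abs_div, abs_of_pos hr, div_lt_one hr] at h3
  have hTcard : m ^ (M + 2) ≤ J ^ (M + 1) * T.card := card_pow_le_card_cellTuples r L (M + 1)
  -- Tuples with the same second differences differ by an arithmetic progression, whose terms lie in
  -- `L - L`.
  obtain ⟨y, -, hy⟩ := exists_card_fiber_mul_ge (s := T)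
    (t := Fintype.piFinset fun _ : Fin M => U)
    (f := fun t i => t ⟨i + 2, by omega⟩ - 2 * t ⟨i + 1, by omega⟩ + t ⟨i, by omega⟩) (by
      intro t ht
      obtain ⟨h1, h2⟩ := hTmem t ht
      refine Fintype.mem_piFinset.2 fun i => Finset.mem_filter.2 ⟨?_, ?_⟩
      · exact Finset.mem_sub.2 ⟨_, Finset.add_mem_add (h1 ⟨i + 2, by omega⟩) (h1 ⟨i, by omega⟩), _,
          Finset.add_mem_add (h1 ⟨i + 1, by omega⟩) (h1 ⟨i + 1, by omega⟩), by ring⟩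
      · have h3 := abs_lt.1 (h2 ⟨i + 2, by omega⟩ ⟨i + 1, by omega⟩)
        have h4 := abs_lt.1 (h2 ⟨i, by omega⟩ ⟨i + 1, by omega⟩)
        exact abs_lt.2 ⟨by linarith, by linarith⟩)
    (Fintype.piFinset_nonempty.2 fun _ => hUne)
  rw [Fintype.card_piFinset_const] at hy
  set T₀ := T.filter fun t => (fun i : Fin M => t ⟨i + 2, by omega⟩ - 2 * t ⟨i + 1, by omega⟩ +
    t ⟨i, by omega⟩) = y with hT₀
  have hy' : (T.card : ℝ) ≤ T₀.card * (U.card : ℝ) ^ M := by exact_mod_cast hy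
  have hT₀mem : ∀ t ∈ T₀, t ∈ T ∧ ∀ s ∈ T₀, ∀ (i : ℕ) (hi : i < M + 2),
      t ⟨i, hi⟩ = s ⟨i, hi⟩ + (t 0 - s 0) + i * ((t 1 - t 0) - (s 1 - s 0)) := by
    intro t ht
    refine ⟨(Finset.mem_filter.1 ht).1, fun s hs => eq_of_second_differences_eq fun i hi => ?_⟩
    exact congrFun ((Finset.mem_filter.1 ht).2.trans (Finset.mem_filter.1 hs).2.symm) ⟨i, hi⟩
  have hT₀card : m ^ 2 ≤ T₀.card * (J * D ^ M) := by
    have h1 : m ^ (M + 2) ≤ T₀.card * J * (D * m) ^ M := by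
      calc m ^ (M + 2) ≤ J ^ (M + 1) * (T₀.card * (U.card : ℝ) ^ M) :=
            hTcard.trans (mul_le_mul_of_nonneg_left hy' (by positivity))
        _ = T₀.card * J * (U.card * J) ^ M := by rw [mul_pow]; ring
        _ ≤ _ := by gcongr
    have h2 : m ^ 2 * m ^ M ≤ T₀.card * (J * D ^ M) * m ^ M := by
      rw [mul_pow] at h1
      calc m ^ 2 * m ^ M = m ^ (M + 2) := by ring
        _ ≤ _ := h1
        _ = _ := by ring
    exact le_of_mul_le_mul_right h2 (by positivity)
  have hT₀big : 2 * m ≤ T₀.card := by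
    have hpos : 0 < J * D ^ M := by positivity
    have h1 : 2 * m * (J * D ^ M) ≤ T₀.card * (J * D ^ M) := by
      calc 2 * m * (J * D ^ M) = m * (2 * J * D ^ M) := by ring
        _ ≤ m * m := mul_le_mul_of_nonneg_left hsmall hmpos.le
        _ = m ^ 2 := by ring
        _ ≤ _ := hT₀card
    exact le_of_mul_le_mul_right h1 hpos
  have hT₀ne : T₀.Nonempty := by
    rw [← Finset.card_pos]
    have : (0 : ℝ) < T₀.card := by linarith
    exact_mod_cast this
  obtain ⟨s, hs⟩ := hT₀ne
  -- `δ t` is the step of the progression `t - s`. It vanishes for at most `|L|` tuples, no more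
  -- than half of `T₀`; a second pigeonhole then fixes a nonzero step `τ`.
  set δ : (Fin (M + 2) → ℝ) → ℝ := fun t => (t 1 - t 0) - (s 1 - s 0) with hδ
  have hδinj : ∀ t ∈ T₀, ∀ t' ∈ T₀, δ t = δ t' → t 0 = t' 0 → t = t' := by
    intro t ht t' ht' h1 h2
    funext ⟨i, hi⟩
    rw [(hT₀mem t ht).2 s hs i hi, (hT₀mem t' ht').2 s hs i hi]
    simp only [hδ] at h1
    rw [h1, h2]
  set T₁ := T₀.filter fun t => δ t ≠ 0 with hT₁
  have hT₁card : (T₀.card : ℝ) ≤ 2 * T₁.card := by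
    have h1 : (T₀.filter fun t => δ t = 0).card ≤ L.card := by
      refine Finset.card_le_card_of_injOn (fun t => t 0) ?_ ?_
      · intro t ht
        exact (hTmem t (hT₀mem t (Finset.mem_filter.1 ht).1).1).1 0
      · intro t ht t' ht' h
        have h1 := Finset.mem_filter.1 ht
        have h2 := Finset.mem_filter.1 ht'
        exact hδinj t h1.1 t' h2.1 (h1.2.trans h2.2.symm) h
    have h2 := Finset.card_filter_add_card_filter_not (s := T₀) (fun t => δ t = 0)
    have h3 : (T₀.card : ℝ) = (T₀.filter fun t => δ t = 0).card + T₁.card := by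
      exact_mod_cast h2.symm
    have h4 : ((T₀.filter fun t => δ t = 0).card : ℝ) ≤ m := Nat.cast_le.2 h1
    linarith
  obtain ⟨τ, -, hτ⟩ := exists_card_fiber_mul_ge (s := T₁) (t := U) (f := δ) (by
    intro t ht
    have ht' := hTmem t (hT₀mem t (Finset.mem_filter.1 ht).1).1
    have hs' := hTmem s (hT₀mem s hs).1
    refine Finset.mem_filter.2 ⟨?_, ?_⟩
    · exact Finset.mem_sub.2 ⟨_, Finset.add_mem_add (ht'.1 1) (hs'.1 0), _,
        Finset.add_mem_add (ht'.1 0) (hs'.1 1), by simp only [hδ]; ring⟩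
    · have h3 := abs_lt.1 (ht'.2 1 0)
      have h4 := abs_lt.1 (hs'.2 1 0)
      exact abs_lt.2 ⟨by simp only [hδ]; linarith, by simp only [hδ]; linarith⟩) hUne
  set V := T₁.filter fun t => δ t = τ with hV
  have hVmem : ∀ t ∈ V, t ∈ T₀ ∧ δ t ≠ 0 ∧ δ t = τ := by
    intro t ht
    have h1 := Finset.mem_filter.1 ht
    have h2 := Finset.mem_filter.1 h1.1
    exact ⟨h2.1, h2.2, h1.2⟩
  have hτ' : (T₁.card : ℝ) ≤ V.card * U.card := by exact_mod_cast hτ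
  have hVne : V.Nonempty := by
    rw [← Finset.card_pos]
    by_contra h0
    have h1 : (V.card : ℝ) = 0 := by exact_mod_cast Nat.eq_zero_of_not_pos h0
    rw [h1, zero_mul] at hτ'
    linarith
  obtain ⟨t₁, ht₁⟩ := hVne
  refine ⟨τ, s 0, V.image fun t => t 0, ?_, ?_, ?_, ?_, ?_⟩
  · intro x hx
    obtain ⟨t, ht, rfl⟩ := Finset.mem_image.1 hx
    exact (hTmem t (hT₀mem t (hVmem t ht).1).1).1 0
  · rw [← (hVmem t₁ ht₁).2.2]
    exact (hVmem t₁ ht₁).2.1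
  · rw [← (hVmem t₁ ht₁).2.2]
    have h3 := abs_lt.1 ((hTmem t₁ (hT₀mem t₁ (hVmem t₁ ht₁).1).1).2 1 0)
    have h4 := abs_lt.1 ((hTmem s (hT₀mem s hs).1).2 1 0)
    exact abs_lt.2 ⟨by simp only [hδ]; linarith, by simp only [hδ]; linarith⟩
  · rw [Finset.card_image_of_injOn]
    · exact le_of_sq_le_chain hmpos hJpos hDpos (Nat.cast_nonneg _) hT₀card
        (by linarith) hUJ
    · intro t ht t' ht' h
      have h1 := hVmem t ht
      have h2 := hVmem t' ht'
      exact hδinj t h1.1 t' h2.1 (h1.2.2.trans h2.2.2.symm) h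
  · intro u hu i hi
    obtain ⟨t, ht, rfl⟩ := Finset.mem_image.1 hu
    have h1 := hVmem t ht
    have h2 := (hT₀mem t h1.1).2 s hs i hi
    refine Finset.mem_sub.2 ⟨t ⟨i, hi⟩, (hTmem t (hT₀mem t h1.1).1).1 _, s ⟨i, hi⟩,
      (hTmem s (hT₀mem s hs).1).1 _, ?_⟩
    rw [h2, ← h1.2.2]
    simp only [hδ]
    ring

/-- Separated starting points of progressions, in the case where `L` meets few cells of size
`R`. -/
theorem exists_separated_progressions {L : Finset ℝ} {K R s : ℝ} (M : ℕ) {G : ℕ} (hG : 0 < G)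
    (hK1 : 1 ≤ K) (hK : ((L + L).card : ℝ) ≤ K * L.card) (hR : 0 < R) (hs : 1 < s)
    (hLs : s ^ 4 = L.card) (hcells : numCells R L < s) (hDs : 4 * (5 * K ^ 5) ^ M ≤ s ^ 2) :
    ∃ τ : ℝ, ∃ Y : Finset ℝ, τ ≠ 0 ∧ |τ| < 2 * R ∧ s ≤ (5 * K ^ 5) ^ (M + 2) * G * Y.card ∧
      (∀ u ∈ Y, ∀ i : ℕ, i < M + 2 → u + i * τ ∈ L - L) ∧ (∀ u ∈ Y, ∀ v ∈ Y, u - v < R) ∧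
      ∀ u ∈ Y, ∀ v ∈ Y, u ≠ v → (G - 1) * |τ| ≤ 2 * |u - v| := by
  classical
  have hs0 : 0 < s := by linarith
  have hL : L.Nonempty := by
    rw [← Finset.card_pos]
    have : (0 : ℝ) < L.card := by rw [← hLs]; positivity
    exact_mod_cast this
  -- About `s ^ 2 = √|L|` cells: few enough compared with `|L|` to produce progressions, and enough
  -- that pigeonholing into the fewer than `s` cells of length `R` still leaves about `s` points.
  obtain ⟨r, hr, hrR, hJ1, hJ2⟩ := exists_scale (L := L) (t := s ^ 2) hR
    (hcells.trans (by nlinarith)) (by rw [← hLs]; exact pow_le_pow_right₀ hs.le (by norm_num))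
  obtain ⟨τ, c, X, hXL, hτ0, hτ, hX, hprog⟩ := exists_many_progressions (r := r) M hL hK1 hK hr (by
    rw [← hLs]
    calc 2 * (numCells r L : ℝ) * (5 * K ^ 5) ^ M ≤ 2 * (2 * s ^ 2) * (5 * K ^ 5) ^ M := by gcongr
      _ = s ^ 2 * (4 * (5 * K ^ 5) ^ M) := by ring
      _ ≤ s ^ 2 * s ^ 2 := by gcongr
      _ = s ^ 4 := by ring)
  obtain ⟨Y, hYX, hYcard, hYR, hYsep⟩ := exists_separated_subset (X := X) hr hR hG
  refine ⟨τ, Y.image fun u => u - c, hτ0, by linarith, ?_, ?_, ?_, ?_⟩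
  · rw [Finset.card_image_of_injective _ sub_left_injective]
    set D : ℝ := 5 * K ^ 5 with hD
    have hKD : 4 * K ≤ D := by
      have h1 : K ≤ K ^ 5 := le_self_pow₀ hK1 (by norm_num)
      rw [hD]; linarith
    have hDpos : 0 < D := by positivity
    have hm : 0 < (L.card : ℝ) := by exact_mod_cast hL.card_pos
    have h1 := card_mul_numCells_le_of_subset hr hK hXL
    have h2 : (numCells r X : ℝ) ≤ numCells R X * G * Y.card := by exact_mod_cast hYcard
    have h3 : (numCells R X : ℝ) ≤ s :=
      le_trans (by exact_mod_cast numCells_mono R hXL) hcells.le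
    have h4 : (L.card : ℝ) * (s * s) ≤ L.card * (s * (D ^ (M + 2) * G * Y.card)) := by
      calc (L.card : ℝ) * (s * s) ≤ (2 * D ^ (M + 1) * X.card) * numCells r L := by
            rw [← pow_two]; gcongr
        _ = 2 * D ^ (M + 1) * (X.card * numCells r L) := by ring
        _ ≤ 2 * D ^ (M + 1) * (numCells r X * (2 * K * L.card)) := by gcongr
        _ = (4 * K) * D ^ (M + 1) * L.card * numCells r X := by ring
        _ ≤ D * D ^ (M + 1) * L.card * (s * G * Y.card) := by
          gcongr
          exact h2.trans (by gcongr)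
        _ = _ := by ring
    exact le_of_mul_le_mul_left (le_of_mul_le_mul_left h4 hm) hs0
  · intro u hu i hi
    obtain ⟨v, hv, rfl⟩ := Finset.mem_image.1 hu
    exact hprog v (hYX hv) i hi
  · intro u hu v hv
    obtain ⟨u, hu', rfl⟩ := Finset.mem_image.1 hu
    obtain ⟨v, hv', rfl⟩ := Finset.mem_image.1 hv
    simpa using hYR u hu' v hv'
  · intro u hu v hv huv
    obtain ⟨u, hu', rfl⟩ := Finset.mem_image.1 hu
    obtain ⟨v, hv', rfl⟩ := Finset.mem_image.1 hv
    have h1 := hYsep u hu' v hv' (fun h => huv (by rw [h]))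
    have hG1 : (0 : ℝ) ≤ (G : ℝ) - 1 := by
      have : (1 : ℝ) ≤ G := by exact_mod_cast hG
      linarith
    rw [sub_sub_sub_cancel_right]
    nlinarith

/-! ### Exponential sums near zero, and digit expansions -/

theorem exists_abs_sum_exp_sub_taylor_le {ι : Type*} [Fintype ι] (e : ι → ℕ) (n : ℕ) :
    ∃ δ B : ℝ, 0 < δ ∧ 0 ≤ B ∧ ∀ τ : ℝ, |τ| ≤ δ →
      |∑ q, Real.exp (e q * τ) - ∑ j ∈ Finset.range (n + 1), τ ^ j / j.factorial * ∑ q, (e q : ℝ) ^ j|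
        ≤ B * |τ| ^ (n + 1) := by
  set c : ℝ := ((n + 1).succ / ((n + 1).factorial * (n + 1 : ℕ)) : ℝ) with hc
  have hc0 : 0 ≤ c := by positivity
  set E : ℝ := 1 + ∑ q, (e q : ℝ) with hE
  have hE1 : 1 ≤ E := by
    have : 0 ≤ ∑ q, (e q : ℝ) := Finset.sum_nonneg fun q _ => by positivity
    linarith
  refine ⟨1 / E, ∑ q, (e q : ℝ) ^ (n + 1) * c, by positivity,
    Finset.sum_nonneg fun q _ => by positivity, fun τ hτ => ?_⟩
  have hswap : ∑ j ∈ Finset.range (n + 1), τ ^ j / j.factorial * ∑ q, (e q : ℝ) ^ j =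
      ∑ q, ∑ j ∈ Finset.range (n + 1), (e q * τ) ^ j / j.factorial := by
    rw [Finset.sum_comm]
    refine Finset.sum_congr rfl fun j _ => ?_
    rw [Finset.mul_sum]
    refine Finset.sum_congr rfl fun q _ => ?_
    rw [mul_pow]; ring
  rw [hswap, ← Finset.sum_sub_distrib, Finset.sum_mul]
  refine (Finset.abs_sum_le_sum_abs _ _).trans (Finset.sum_le_sum fun q _ => ?_)
  have hq : (e q : ℝ) ≤ E := by
    have := Finset.single_le_sum (f := fun q => (e q : ℝ)) (fun q _ => by positivity)
      (Finset.mem_univ q)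
    linarith
  have hle : |(e q : ℝ) * τ| ≤ 1 := by
    rw [abs_mul, Nat.abs_cast]
    calc (e q : ℝ) * |τ| ≤ E * (1 / E) := by gcongr
      _ = 1 := by field_simp
  refine (Real.exp_bound hle (Nat.succ_pos n)).trans (le_of_eq ?_)
  rw [abs_mul, Nat.abs_cast, mul_pow, hc, Nat.succ_eq_add_one]
  ring

/-- The difference of two exponential sums vanishes at `0` to the first order at which the power
sums of the frequencies differ. -/
theorem exists_expSum_bounds {ι : Type*} [Fintype ι] {e f : ι → ℕ} {o : ℕ}
    (heq : ∀ j < o, ∑ q, e q ^ j = ∑ q, f q ^ j) (hne : ∑ q, e q ^ o ≠ ∑ q, f q ^ o) :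
    ∃ δ a b : ℝ, 0 < δ ∧ 0 < a ∧ 0 < b ∧ ∀ τ : ℝ, |τ| ≤ δ →
      a * |τ| ^ o ≤ |∑ q, Real.exp (e q * τ) - ∑ q, Real.exp (f q * τ)| ∧
      |∑ q, Real.exp (e q * τ) - ∑ q, Real.exp (f q * τ)| ≤ b * |τ| ^ o := by
  obtain ⟨δ₁, B₁, hδ₁, hB₁, h₁⟩ := exists_abs_sum_exp_sub_taylor_le e o
  obtain ⟨δ₂, B₂, hδ₂, hB₂, h₂⟩ := exists_abs_sum_exp_sub_taylor_le f o
  set d : ℝ := ∑ q, (e q : ℝ) ^ o - ∑ q, (f q : ℝ) ^ o with hd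
  have hd0 : d ≠ 0 := by
    rw [hd, sub_ne_zero]
    exact_mod_cast hne
  set a : ℝ := |d| / o.factorial with ha
  have ha0 : 0 < a := by positivity
  have hB : 0 ≤ B₁ + B₂ := by positivity
  refine ⟨min (min δ₁ δ₂) (a / (2 * (B₁ + B₂ + 1))), a / 2, 2 * a, by positivity, by positivity,
    by positivity, fun τ hτ => ?_⟩
  have hτ₁ := h₁ τ (hτ.trans ((min_le_left _ _).trans (min_le_left _ _)))
  have hτ₂ := h₂ τ (hτ.trans ((min_le_left _ _).trans (min_le_right _ _)))
  have hτ₃ := hτ.trans (min_le_right _ _)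
  have hmain : ∑ j ∈ Finset.range (o + 1), τ ^ j / j.factorial * ∑ q, (e q : ℝ) ^ j -
      ∑ j ∈ Finset.range (o + 1), τ ^ j / j.factorial * ∑ q, (f q : ℝ) ^ j =
        τ ^ o / o.factorial * d := by
    rw [Finset.sum_range_succ, Finset.sum_range_succ, Finset.sum_congr rfl
      (g := fun j => τ ^ j / j.factorial * ∑ q, (f q : ℝ) ^ j)]
    · rw [hd]; ring
    · intro j hj
      have : ∑ q, (e q : ℝ) ^ j = ∑ q, (f q : ℝ) ^ j := by
        exact_mod_cast heq j (Finset.mem_range.1 hj)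
      rw [this]
  have hmainabs : |τ ^ o / o.factorial * d| = a * |τ| ^ o := by
    rw [abs_mul, abs_div, abs_pow, Nat.abs_cast, ha]; ring
  have herr : (B₁ + B₂) * |τ| ^ (o + 1) ≤ a / 2 * |τ| ^ o := by
    have h3 : (B₁ + B₂) * |τ| ≤ a / 2 := by
      calc (B₁ + B₂) * |τ| ≤ (B₁ + B₂ + 1) * (a / (2 * (B₁ + B₂ + 1))) :=
          mul_le_mul (by linarith) hτ₃ (abs_nonneg _) (by linarith)
        _ = a / 2 := by field_simp
    calc _ = ((B₁ + B₂) * |τ|) * |τ| ^ o := by ring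
      _ ≤ _ := by gcongr
  set P := ∑ q, Real.exp (e q * τ)
  set Q := ∑ q, Real.exp (f q * τ)
  set P' := ∑ j ∈ Finset.range (o + 1), τ ^ j / j.factorial * ∑ q, (e q : ℝ) ^ j
  set Q' := ∑ j ∈ Finset.range (o + 1), τ ^ j / j.factorial * ∑ q, (f q : ℝ) ^ j
  have hdiff : |(P - Q) - (P' - Q')| ≤ a / 2 * |τ| ^ o := by
    calc |(P - Q) - (P' - Q')| = |(P - P') - (Q - Q')| := by ring_nf
      _ ≤ |P - P'| + |Q - Q'| := abs_sub _ _
      _ ≤ B₁ * |τ| ^ (o + 1) + B₂ * |τ| ^ (o + 1) := add_le_add hτ₁ hτ₂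
      _ = (B₁ + B₂) * |τ| ^ (o + 1) := by ring
      _ ≤ _ := herr
  rw [hmain] at hdiff
  have h4 := abs_sub_abs_le_abs_sub (P - Q) (τ ^ o / o.factorial * d)
  have h5 := abs_sub_abs_le_abs_sub (τ ^ o / o.factorial * d) (P - Q)
  rw [abs_sub_comm (τ ^ o / o.factorial * d) (P - Q)] at h5
  have h6 : 0 ≤ a * |τ| ^ o := by positivity
  constructor <;> linarith

/-- At the lowest order `o` where two words differ the term is at least `g * a * t ^ (o + 1)`. All
higher orders together give at most `|O| * b * Λ * t ^ (o + 1)`, too little to cancel it by `hgap`.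
-/
theorem injOn_digit_sum {O : Finset ℕ} {Y : Finset ℝ} {Q : ℕ → ℝ} {φ : ℝ → ℝ} {a b t Λ g : ℝ}
    (ht0 : 0 < t) (ht1 : t ≤ 1) (ha : 0 < a) (hΛ : 0 ≤ Λ)
    (hQ : ∀ o ∈ O, a * t ^ o ≤ |Q o| ∧ |Q o| ≤ b * t ^ o)
    (hdiam : ∀ u ∈ Y, ∀ v ∈ Y, |φ u - φ v| ≤ Λ)
    (hsep : ∀ u ∈ Y, ∀ v ∈ Y, u ≠ v → g * t ≤ |φ u - φ v|) (hgap : O.card * (b * Λ) < g * a) :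
    Set.InjOn (fun w : O → ℝ => ∑ o : O, φ (w o) * Q o)
      (Fintype.piFinset fun _ : O => Y : Finset (O → ℝ)) := by
  classical
  intro w hw w' hw' heq
  have hY := Fintype.mem_piFinset.1 (Finset.mem_coe.1 hw)
  have hY' := Fintype.mem_piFinset.1 (Finset.mem_coe.1 hw')
  by_contra hne
  obtain ⟨o₁, ho₁⟩ := Function.ne_iff.1 hne
  set F : Finset O := Finset.univ.filter fun o => w o ≠ w' o with hF
  obtain ⟨o, hoF, hmin⟩ := Finset.exists_min_image F (fun o => (o : ℕ))
    ⟨o₁, Finset.mem_filter.2 ⟨Finset.mem_univ _, ho₁⟩⟩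
  have ho := (Finset.mem_filter.1 hoF).2
  have hzero : ∑ o : O, (φ (w o) - φ (w' o)) * Q o = 0 := by
    simp only [sub_mul, Finset.sum_sub_distrib]
    exact sub_eq_zero.2 heq
  rw [← Finset.add_sum_erase _ _ (Finset.mem_univ o)] at hzero
  have hlow : g * a * t ^ ((o : ℕ) + 1) ≤ |(φ (w o) - φ (w' o)) * Q o| := by
    rw [abs_mul]
    calc g * a * t ^ ((o : ℕ) + 1) = (g * t) * (a * t ^ (o : ℕ)) := by ring
      _ ≤ _ := by
        gcongr
        · exact hsep _ (hY o) _ (hY' o) ho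
        · exact (hQ o o.2).1
  have hb : 0 ≤ b := by
    have h1 := (hQ o o.2).1.trans (hQ o o.2).2
    have h2 := pow_pos ht0 (o : ℕ)
    by_contra hb
    nlinarith [mul_pos ha h2, mul_pos (neg_pos.2 (not_le.1 hb)) h2]
  have hup : |∑ i ∈ Finset.univ.erase o, (φ (w i) - φ (w' i)) * Q i| ≤
      O.card * (b * Λ) * t ^ ((o : ℕ) + 1) := by
    calc _ ≤ ∑ i ∈ Finset.univ.erase o, |(φ (w i) - φ (w' i)) * Q i| :=
          Finset.abs_sum_le_sum_abs _ _
      _ ≤ ∑ i ∈ Finset.univ.erase o, b * Λ * t ^ ((o : ℕ) + 1) := by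
          refine Finset.sum_le_sum fun i hi => ?_
          have hio := (Finset.mem_erase.1 hi).1
          by_cases hwi : w i = w' i
          · rw [hwi, sub_self, zero_mul, abs_zero]; positivity
          · have h1 := hmin i (Finset.mem_filter.2 ⟨Finset.mem_univ _, hwi⟩)
            have h2 : (o : ℕ) + 1 ≤ i := by
              have : (o : ℕ) ≠ i := fun h => hio (Subtype.ext h.symm)
              omega
            rw [abs_mul]
            calc |φ (w i) - φ (w' i)| * |Q i| ≤ Λ * (b * t ^ (i : ℕ)) := by
                  gcongr
                  · exact hdiam _ (hY i) _ (hY' i)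
                  · exact (hQ i i.2).2
              _ ≤ Λ * (b * t ^ ((o : ℕ) + 1)) := by
                  gcongr 2
                  exact pow_le_pow_of_le_one ht0.le ht1 h2
              _ = _ := by ring
      _ ≤ ∑ _i : O, b * Λ * t ^ ((o : ℕ) + 1) :=
          Finset.sum_le_sum_of_subset_of_nonneg (Finset.subset_univ _) fun _ _ _ => by positivity
      _ = _ := by
          rw [Finset.sum_const, Finset.card_univ, Fintype.card_coe, nsmul_eq_mul]; ring
  rw [eq_neg_of_add_eq_zero_left hzero, abs_neg] at hlow
  have := hlow.trans hup
  exact absurd (le_of_mul_le_mul_right this (by positivity)) (not_le.2 hgap)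

theorem sum_add_nsmul_mem_hFoldSumset {ι : Type*} [Fintype ι] {h : ℕ} (hι : Fintype.card ι ≤ h)
    {S : Finset ℝ} {s₀ : ℝ} (hs₀ : s₀ ∈ S) {s : ι → ℝ} (hs : ∀ i, s i ∈ S) :
    ∑ i, s i + (h - Fintype.card ι) • s₀ ∈ hFoldSumset h S := by
  classical
  have hcard : Fintype.card (Fin h) = Fintype.card (ι ⊕ Fin (h - Fintype.card ι)) := by
    simp; omega
  let E := Fintype.equivOfCardEq hcard
  refine Finset.mem_image.2 ⟨fun i => Sum.elim s (fun _ => s₀) (E i), ?_, ?_⟩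
  · refine Fintype.mem_piFinset.2 fun i => ?_
    rcases E i with j | j
    · exact hs j
    · exact hs₀
  · rw [Equiv.sum_comp E (Sum.elim s fun _ => s₀), Fintype.sum_sum_type]
    simp

/-- Both sums are padded to `h` terms by the same fixed element, so the pair of padded sums
determines the difference, hence `w`. -/
theorem card_le_sq_card_hFoldSumset {α ι : Type*} [Fintype ι] {h : ℕ} (hι : Fintype.card ι ≤ h)
    {S : Finset ℝ} (hS : S.Nonempty) {F : Finset α} {P Q : α → ι → ℝ}
    (hP : ∀ w ∈ F, ∀ i, P w i ∈ S) (hQ : ∀ w ∈ F, ∀ i, Q w i ∈ S)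
    (hinj : Set.InjOn (fun w => ∑ i, P w i - ∑ i, Q w i) F) :
    F.card ≤ (hFoldSumset h S).card ^ 2 := by
  classical
  obtain ⟨s₀, hs₀⟩ := hS
  rw [pow_two, ← Finset.card_product]
  refine Finset.card_le_card_of_injOn (fun w => (∑ i, P w i + (h - Fintype.card ι) • s₀,
    ∑ i, Q w i + (h - Fintype.card ι) • s₀)) ?_ ?_
  · intro w hw
    exact Finset.mem_coe.2 (Finset.mem_product.2
      ⟨sum_add_nsmul_mem_hFoldSumset hι hs₀ (hP w hw),
        sum_add_nsmul_mem_hFoldSumset hι hs₀ (hQ w hw)⟩)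
  · intro w hw w' hw' heq
    simp only [Prod.mk.injEq, add_left_inj] at heq
    exact hinj hw hw' (by simp only [heq.1, heq.2])

theorem card_le_card_hFoldSumset {h : ℕ} (hh : 1 ≤ h) {S : Finset ℝ} :
    S.card ≤ (hFoldSumset h S).card := by
  classical
  rcases S.eq_empty_or_nonempty with rfl | ⟨s₀, hs₀⟩
  · simp
  refine Finset.card_le_card_of_injOn (fun s => ∑ _i : Unit, s + (h - Fintype.card Unit) • s₀) ?_ ?_
  · intro s hs
    exact sum_add_nsmul_mem_hFoldSumset (by simpa using hh) hs₀ fun _ => hs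
  · intro s _ s' _ heq
    simpa using heq

/-! ### Lacunary sets and passage to logarithms -/

/-- Above `w` the two sums coincide. Below it `S'` has at most `q` points, each contributing at most
`exp w / (q + 1)` because `exp q ≥ q + 1`. -/
theorem sum_exp_lt_sum_exp {q : ℕ} {Y S S' : Finset ℝ}
    (hY : ∀ u ∈ Y, ∀ v ∈ Y, v < u → q ≤ u - v) (hS : S ⊆ Y) (hS' : S' ⊆ Y) (hq : S'.card ≤ q)
    {w : ℝ} (hw : w ∈ S) (hw' : w ∉ S') (hmax : ∀ v, w < v → (v ∈ S ↔ v ∈ S')) :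
    ∑ u ∈ S', Real.exp u < ∑ u ∈ S, Real.exp u := by
  classical
  rw [← Finset.sum_filter_add_sum_filter_not S' (fun v => w < v),
    ← Finset.sum_filter_add_sum_filter_not S (fun v => w < v)]
  have h1 : S'.filter (fun v => w < v) = S.filter (fun v => w < v) := by
    ext v
    simp only [Finset.mem_filter]
    constructor
    · exact fun h => ⟨(hmax v h.2).2 h.1, h.2⟩
    · exact fun h => ⟨(hmax v h.2).1 h.1, h.2⟩
  rw [h1, add_lt_add_iff_left]
  have hexp := Real.exp_pos w
  have h2 : ∑ u ∈ S'.filter (fun v => ¬ w < v), Real.exp u ≤ q * (Real.exp w / (q + 1)) := by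
    calc _ ≤ (S'.filter fun v => ¬ w < v).card • (Real.exp w / (q + 1)) := by
          refine Finset.sum_le_card_nsmul _ _ _ fun u hu => ?_
          obtain ⟨hu, hle⟩ := Finset.mem_filter.1 hu
          have hlt : u < w := lt_of_le_of_ne (not_lt.1 hle) fun h => hw' (h ▸ hu)
          have h3 := hY w (hS hw) u (hS' hu) hlt
          rw [le_div_iff₀ (by positivity)]
          calc Real.exp u * (q + 1) ≤ Real.exp u * Real.exp q := by
                gcongr
                exact Real.add_one_le_exp _
            _ = Real.exp (u + q) := (Real.exp_add _ _).symm
            _ ≤ Real.exp w := Real.exp_le_exp.2 (by linarith)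
      _ ≤ q * (Real.exp w / (q + 1)) := by
          rw [nsmul_eq_mul]
          gcongr
          exact (Finset.card_filter_le _ _).trans hq
  have h3 : (q : ℝ) * (Real.exp w / (q + 1)) < Real.exp w := by
    rw [mul_div_assoc', div_lt_iff₀ (by positivity)]
    nlinarith
  have h4 : Real.exp w ≤ ∑ u ∈ S.filter (fun v => ¬ w < v), Real.exp u :=
    Finset.single_le_sum (f := Real.exp) (fun u _ => (Real.exp_pos u).le)
      (Finset.mem_filter.2 ⟨hw, lt_irrefl w⟩)
  linarith

theorem injOn_sum_exp_powersetCard {q : ℕ} {Y : Finset ℝ}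
    (hY : ∀ u ∈ Y, ∀ v ∈ Y, v < u → q ≤ u - v) :
    Set.InjOn (fun S : Finset ℝ => ∑ u ∈ S, Real.exp u) (Y.powersetCard q : Finset (Finset ℝ)) := by
  classical
  intro S hS S' hS' heq
  obtain ⟨hSY, hSq⟩ := Finset.mem_powersetCard.1 (Finset.mem_coe.1 hS)
  obtain ⟨hSY', hSq'⟩ := Finset.mem_powersetCard.1 (Finset.mem_coe.1 hS')
  by_contra hne
  have hne' : (symmDiff S S').Nonempty := by
    rw [Finset.nonempty_iff_ne_empty]
    exact fun h => hne (symmDiff_eq_bot.1 h)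
  obtain ⟨w, hw, hmax⟩ := Finset.exists_max_image _ id hne'
  have hmax' : ∀ v, w < v → (v ∈ S ↔ v ∈ S') := by
    intro v hv
    by_contra hiff
    have : v ∈ symmDiff S S' := by
      rw [Finset.mem_symmDiff]; tauto
    exact absurd (hmax v this) (not_le.2 hv)
  rcases Finset.mem_symmDiff.1 hw with ⟨h1, h2⟩ | ⟨h1, h2⟩
  · exact (sum_exp_lt_sum_exp hY hSY hSY' hSq'.le h1 h2 hmax').ne heq.symm
  · exact (sum_exp_lt_sum_exp hY hSY' hSY hSq.le h1 h2 fun v hv => (hmax' v hv).symm).ne heq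

/-- Passing to logarithms: up to a dilation, `A * A` contains the exponentials of the differences
of a large set with few sums. -/
theorem exists_log_set {A : Finset ℝ} (hA : 2 ≤ A.card) :
    ∃ (L : Finset ℝ) (y : ℝ), y ≠ 0 ∧ (L + L).card ≤ (A * A).card ∧
      A.card ^ 2 ≤ 16 * (L.card * (A * A).card) ∧ ∀ u ∈ L - L, y * Real.exp u ∈ A * A := by
  classical
  obtain ⟨B, hBpos, hBB, hBcard⟩ : ∃ B : Finset ℝ, (∀ b ∈ B, 0 < b) ∧ B * B ⊆ A * A ∧
      A.card ≤ 2 * B.card + 1 := by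
    have hsplit : A.card ≤ (A.filter (0 < ·)).card + ((-A).filter (0 < ·)).card + 1 := by
      have h1 : A ⊆ A.filter (0 < ·) ∪ ((-A).filter (0 < ·)).image Neg.neg ∪ {0} := by
        intro a ha
        rcases lt_trichotomy a 0 with h | h | h
        · refine Finset.mem_union_left _ (Finset.mem_union_right _ (Finset.mem_image.2
            ⟨-a, Finset.mem_filter.2 ⟨by simpa using ha, by simpa using h⟩, neg_neg a⟩))
        · exact Finset.mem_union_right _ (by simp [h])
        · exact Finset.mem_union_left _ (Finset.mem_union_left _ (Finset.mem_filter.2 ⟨ha, h⟩))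
      refine (Finset.card_le_card h1).trans ((Finset.card_union_le _ _).trans ?_)
      refine Nat.add_le_add ((Finset.card_union_le _ _).trans ?_) (by simp)
      exact Nat.add_le_add_left Finset.card_image_le _
    rcases le_total (A.filter (0 < ·)).card ((-A).filter (0 < ·)).card with h | h
    · refine ⟨(-A).filter (0 < ·), fun b hb => (Finset.mem_filter.1 hb).2, ?_, by omega⟩
      calc _ ⊆ (-A) * (-A) :=
            Finset.mul_subset_mul (Finset.filter_subset _ _) (Finset.filter_subset _ _)
        _ = A * A := neg_mul_neg A A
        _ ⊆ A * A := subset_rfl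
    · exact ⟨A.filter (0 < ·), fun b hb => (Finset.mem_filter.1 hb).2,
        Finset.mul_subset_mul (Finset.filter_subset _ _) (Finset.filter_subset _ _), by omega⟩
  have hBne : B.Nonempty := by
    rw [← Finset.card_pos]; omega
  -- For the most popular product `y`, the set `C` consists of `c ∈ B` with `y / c ∈ B`, so `y * (c
  -- / c') = c * (y / c')` is again a product.
  obtain ⟨y, hy, hfib⟩ := exists_card_fiber_mul_ge (s := B ×ˢ B) (t := B * B)
    (f := fun p : ℝ × ℝ => p.1 * p.2) (fun p hp => by
      have := Finset.mem_product.1 hp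
      exact Finset.mul_mem_mul this.1 this.2) (hBne.mul hBne)
  set F := (B ×ˢ B).filter fun p : ℝ × ℝ => p.1 * p.2 = y with hF
  have hFm : ∀ p ∈ F, p.1 ∈ B ∧ p.2 ∈ B ∧ p.1 * p.2 = y := by
    intro p hp
    simpa [hF, and_assoc] using hp
  set C := F.image Prod.fst with hC
  have hCm : ∀ c ∈ C, 0 < c ∧ c ∈ B ∧ y / c ∈ B := by
    intro c hc
    obtain ⟨p, hp, rfl⟩ := Finset.mem_image.1 hc
    obtain ⟨h1, h2, h3⟩ := hFm p hp
    have h0 := hBpos _ h1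
    refine ⟨h0, h1, ?_⟩
    rw [← h3, mul_div_cancel_left₀ _ h0.ne']
    exact h2
  have hCcard : C.card = F.card := by
    refine Finset.card_image_of_injOn fun p hp p' hp' h => Prod.ext h ?_
    obtain ⟨h1, h2, h3⟩ := hFm p hp
    obtain ⟨h1', h2', h3'⟩ := hFm p' hp'
    have h0 := hBpos _ h1
    rw [← h3', ← h] at h3
    exact mul_left_cancel₀ h0.ne' h3
  have hLcard : (C.image Real.log).card = C.card := Finset.card_image_of_injOn fun c hc c' hc' h =>
    Real.log_injOn_pos (hCm c hc).1 (hCm c' hc').1 h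
  refine ⟨C.image Real.log, y, ?_, ?_, ?_, ?_⟩
  · obtain ⟨b, hb, b', hb', rfl⟩ := Finset.mem_mul.1 hy
    exact (mul_pos (hBpos b hb) (hBpos b' hb')).ne'
  · have h1 : C.image Real.log + C.image Real.log ⊆ (A * A).image Real.log := by
      intro z hz
      obtain ⟨u, hu, v, hv, rfl⟩ := Finset.mem_add.1 hz
      obtain ⟨c, hc, rfl⟩ := Finset.mem_image.1 hu
      obtain ⟨c', hc', rfl⟩ := Finset.mem_image.1 hv
      refine Finset.mem_image.2 ⟨c * c', hBB (Finset.mul_mem_mul (hCm c hc).2.1 (hCm c' hc').2.1), ?_⟩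
      exact Real.log_mul (hCm c hc).1.ne' (hCm c' hc').1.ne'
    exact (Finset.card_le_card h1).trans Finset.card_image_le
  · rw [hLcard, hCcard]
    rw [Finset.card_product] at hfib
    have h2 : F.card * (B * B).card ≤ F.card * (A * A).card :=
      Nat.mul_le_mul_left _ (Finset.card_le_card hBB)
    have h3 : A.card ≤ 4 * B.card := by omega
    nlinarith
  · intro u hu
    obtain ⟨v, hv, w, hw, rfl⟩ := Finset.mem_sub.1 hu
    obtain ⟨c, hc, rfl⟩ := Finset.mem_image.1 hv
    obtain ⟨c', hc', rfl⟩ := Finset.mem_image.1 hw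
    rw [Real.exp_sub, Real.exp_log (hCm c hc).1, Real.exp_log (hCm c' hc').1]
    have : y * (c / c') = c * (y / c') := by ring
    rw [this]
    exact hBB (Finset.mul_mem_mul (hCm c hc).2.1 (hCm c' hc').2.2)

theorem exists_numCells_le_two (L : Finset ℝ) : ∃ R : ℝ, 0 < R ∧ numCells R L ≤ 2 := by
  classical
  have h0 : 0 ≤ ∑ u ∈ L, |u| := Finset.sum_nonneg fun _ _ => abs_nonneg _
  refine ⟨1 + ∑ u ∈ L, |u|, by positivity, ?_⟩
  set R := 1 + ∑ u ∈ L, |u| with hR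
  have : L.image (fun u => ⌊u / R⌋) ⊆ {-1, 0} := by
    intro z hz
    obtain ⟨u, hu, rfl⟩ := Finset.mem_image.1 hz
    have h1 : |u| ≤ ∑ u ∈ L, |u| := Finset.single_le_sum (fun _ _ => abs_nonneg _) hu
    have hRpos : 0 < R := by positivity
    have h2 := abs_le.1 h1
    have h3 : -1 ≤ ⌊u / R⌋ := Int.le_floor.2 (by
      push_cast
      rw [le_div_iff₀ hRpos]; linarith)
    have h4 : ⌊u / R⌋ < 1 := Int.floor_lt.2 (by
      push_cast
      rw [div_lt_iff₀ hRpos]; linarith)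
    simp only [Finset.mem_insert, Finset.mem_singleton]
    omega
  exact (Finset.card_le_card this).trans Finset.card_le_two

/-- Lower bound for sumsets of sets containing a lacunary set. -/
theorem choose_le_card_hFoldSumset {h q : ℕ} (hq : q ≤ h) {S Y : Finset ℝ} (hS : S.Nonempty)
    {y : ℝ} (hy : y ≠ 0) (hYS : ∀ u ∈ Y, y * Real.exp u ∈ S)
    (hY : ∀ u ∈ Y, ∀ v ∈ Y, v < u → q ≤ u - v) :
    Y.card.choose q ≤ (hFoldSumset h S).card := by
  classical
  obtain ⟨s₀, hs₀⟩ := hS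
  rw [← Finset.card_powersetCard]
  refine Finset.card_le_card_of_injOn
    (fun T => y * (∑ u ∈ T, Real.exp u) + (h - q) • s₀) ?_ ?_
  · intro T hT
    obtain ⟨hTY, hTq⟩ := Finset.mem_powersetCard.1 (Finset.mem_coe.1 hT)
    have := sum_add_nsmul_mem_hFoldSumset (ι := T) (h := h) (by simpa [hTq] using hq) hs₀
      (s := fun u => y * Real.exp u) (fun u => hYS u (hTY u.2))
    rw [Fintype.card_coe, hTq, Finset.sum_coe_sort T fun u => y * Real.exp u,
      ← Finset.mul_sum] at this
    exact this
  · intro T hT T' hT' heq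
    simp only [add_left_inj] at heq
    exact injOn_sum_exp_powersetCard hY hT hT' (mul_left_cancel₀ hy heq)

theorem pow_le_pow_mul_choose {n q : ℕ} (h : 2 * q ≤ n) : n ^ q ≤ (2 * q) ^ q * n.choose q := by
  have h1 : (n + 1 - q) ^ q ≤ q.factorial * n.choose q := by
    rw [← Nat.descFactorial_eq_factorial_mul_choose]
    exact n.pow_sub_le_descFactorial q
  calc n ^ q ≤ (2 * (n + 1 - q)) ^ q := Nat.pow_le_pow_left (by omega) _
    _ = 2 ^ q * (n + 1 - q) ^ q := mul_pow _ _ _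
    _ ≤ 2 ^ q * (q ^ q * n.choose q) := by
      gcongr
      exact h1.trans (Nat.mul_le_mul_right _ (Nat.factorial_le_pow q))
    _ = _ := by rw [mul_pow]; ring

/-! ### The main estimate -/

/-- Lower bound for sumsets of sets containing progressions `u + i * τ`, in exponential form. -/
theorem card_pow_le_sq_card_hFoldSumset {κ : Type*} [Fintype κ] {h N G : ℕ} {O : Finset ℕ}
    {e f : ℕ → κ → ℕ} {a b τ y : ℝ} {S Y : Finset ℝ} (hcard : O.card * Fintype.card κ ≤ h)
    (hS : S.Nonempty) (hYne : Y.Nonempty) (he : ∀ o ∈ O, ∀ q, e o q ≤ N)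
    (hf : ∀ o ∈ O, ∀ q, f o q ≤ N) (hy : y ≠ 0)
    (hYS : ∀ u ∈ Y, ∀ i : ℕ, i ≤ N → y * Real.exp (u + i * τ) ∈ S) (hτ0 : τ ≠ 0) (hτ1 : |τ| ≤ 1)
    (ha : 0 < a)
    (hQ : ∀ o ∈ O, a * |τ| ^ o ≤ |∑ q, Real.exp (e o q * τ) - ∑ q, Real.exp (f o q * τ)| ∧
      |∑ q, Real.exp (e o q * τ) - ∑ q, Real.exp (f o q * τ)| ≤ b * |τ| ^ o)
    (hdiam : ∀ u ∈ Y, ∀ v ∈ Y, u - v ≤ 1)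
    (hsep : ∀ u ∈ Y, ∀ v ∈ Y, u ≠ v → (G - 1) * |τ| ≤ 2 * |u - v|)
    (hgap : O.card * (b * 3) < (G - 1) / 6 * a) :
    Y.card ^ O.card ≤ (hFoldSumset h S).card ^ 2 := by
  classical
  obtain ⟨u₀, hu₀⟩ := hYne
  -- After division by `exp u₀` the values on `Y` lie in `[1/3, 3]`; hence `Λ = 3`, and the
  -- separation `(G - 1) * |τ| / 2` becomes `(G - 1) * |τ| / 6`.
  set φ : ℝ → ℝ := fun u => Real.exp (u - u₀) with hφ
  have hφ3 : ∀ u ∈ Y, φ u ≤ 3 := fun u hu =>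
    (Real.exp_le_exp.2 (hdiam u hu u₀ hu₀)).trans (by linarith [Real.exp_one_lt_d9])
  have hφpos : ∀ u, 0 < φ u := fun u => Real.exp_pos _
  have hφinv : ∀ u ∈ Y, 1 / 3 ≤ φ u := by
    intro u hu
    have h1 : Real.exp (-1) ≤ φ u := Real.exp_le_exp.2 (by linarith [hdiam u₀ hu₀ u hu])
    refine le_trans ?_ h1
    rw [Real.exp_neg, one_div]
    exact inv_anti₀ (Real.exp_pos 1) (by linarith [Real.exp_one_lt_d9])
  have hφsep : ∀ u ∈ Y, ∀ v ∈ Y, v < u → (G - 1) / 6 * |τ| ≤ φ u - φ v := by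
    intro u hu v hv hvu
    have h1 := hsep u hu v hv hvu.ne'
    rw [abs_of_pos (sub_pos.2 hvu)] at h1
    have h2 : φ u = φ v * Real.exp (u - v) := by
      simp only [hφ]
      rw [← Real.exp_add]; ring_nf
    have h3 := Real.add_one_le_exp (u - v)
    have h4 := hφinv v hv
    calc (G - 1) / 6 * |τ| ≤ 1 / 3 * (u - v) := by linarith
      _ ≤ φ v * (u - v) := by
        have : 0 ≤ u - v := by linarith
        gcongr
      _ ≤ φ v * (Real.exp (u - v) - 1) := by
        exact mul_le_mul_of_nonneg_left (by linarith) (hφpos v).le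
      _ = φ u - φ v := by rw [h2]; ring
  have hinj := injOn_digit_sum (O := O) (Y := Y) (φ := φ) (a := a) (b := b) (t := |τ|) (Λ := 3)
    (g := (G - 1) / 6) (abs_pos.2 hτ0) hτ1 ha (by norm_num) hQ (by
      intro u hu v hv
      exact abs_le.2 ⟨by linarith [hφ3 v hv, hφpos u], by linarith [hφ3 u hu, hφpos v]⟩) (by
      intro u hu v hv huv
      rcases lt_or_gt_of_ne huv with h | h
      · rw [abs_sub_comm]
        exact (hφsep v hv u hu h).trans (le_abs_self _)
      · exact (hφsep u hu v hv h).trans (le_abs_self _)) hgap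
  have hcard' : Y.card ^ O.card = (Fintype.piFinset fun _ : O => Y).card := by
    rw [Fintype.card_piFinset (fun _ : O => Y)]
    simp
  rw [hcard']
  refine card_le_sq_card_hFoldSumset (ι := O × κ) (by simpa using hcard) hS
    (P := fun w i => y * Real.exp (w i.1 + (e i.1 i.2 : ℕ) * τ))
    (Q := fun w i => y * Real.exp (w i.1 + (f i.1 i.2 : ℕ) * τ)) ?_ ?_ ?_
  · exact fun w hw i => hYS _ (Fintype.mem_piFinset.1 hw i.1) _ (he _ i.1.2 _)
  · exact fun w hw i => hYS _ (Fintype.mem_piFinset.1 hw i.1) _ (hf _ i.1.2 _)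
  · have hrw : ∀ (w : O → ℝ) (g : ℕ → κ → ℕ),
        ∑ i : O × κ, y * Real.exp (w i.1 + (g i.1 i.2 : ℕ) * τ) =
          y * Real.exp u₀ * ∑ o : O, φ (w o) * ∑ q, Real.exp (g o q * τ) := by
      intro w g
      rw [Fintype.sum_prod_type, Finset.mul_sum]
      refine Finset.sum_congr rfl fun o _ => ?_
      rw [Finset.mul_sum, Finset.mul_sum]
      refine Finset.sum_congr rfl fun q _ => ?_
      simp only [hφ]
      rw [Real.exp_add, Real.exp_sub]
      field_simp
    intro w hw w' hw' heq
    refine hinj hw hw' (mul_left_cancel₀ (mul_ne_zero hy (Real.exp_pos u₀).ne') ?_)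
    simp only [hrw] at heq
    rw [← mul_sub, ← mul_sub, ← Finset.sum_sub_distrib, ← Finset.sum_sub_distrib] at heq
    simp only [← mul_sub] at heq
    exact heq

theorem exists_pos_forall_le {O : Finset ℕ} {g : ℕ → ℝ} (hg : ∀ o ∈ O, 0 < g o) :
    ∃ a, 0 < a ∧ ∀ o ∈ O, a ≤ g o := by
  have h : ∀ᶠ a in nhdsWithin (0 : ℝ) (Set.Ioi 0), ∀ o ∈ O, a ≤ g o := by
    rw [Filter.eventually_all_finset]
    intro o ho
    filter_upwards [Ioo_mem_nhdsGT (hg o ho)] with a ha using ha.2.le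
  obtain ⟨a, h1, h2⟩ := (h.and self_mem_nhdsWithin).exists
  exact ⟨a, h2, h1⟩

/-- The main estimate: with `x = |A| ^ (1 / 100)`, and `δ` the normalized size of `A * A`. -/
theorem exists_pow_le_card_hFoldSumset {h k : ℕ} (hk : k ^ 3 ≤ h) :
    ∃ (q M : ℕ) (X₀ : ℝ), k ≤ 6 * q + 1 ∧ ∀ x : ℝ, X₀ ≤ x → ∀ (A : Finset ℝ) (δ : ℝ),
      x ^ 100 = A.card → 1 ≤ δ → δ ^ (10 * (M + 2)) ≤ x → ((A * A).card : ℝ) ≤ A.card * δ →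
        x ^ (10 * q) ≤ (hFoldSumset h (A * A)).card := by
  classical
  obtain ⟨N, O, hOk, hkO, hO⟩ := exists_powerSum_orders k
  choose! e f he hf heq hne using hO
  have hb := fun o ho => exists_expSum_bounds (heq o ho) (hne o ho)
  choose! δ₀ a₀ b₀ hδ₀ ha₀ hb₀ hbound using hb
  obtain ⟨δ₁, hδ₁, hδ₁le⟩ := exists_pos_forall_le hδ₀
  obtain ⟨a, ha, hale⟩ := exists_pos_forall_le ha₀
  obtain ⟨b, hble⟩ := (O.image b₀).exists_le
  have hble' : ∀ o ∈ O, b₀ o ≤ b := fun o ho => hble _ (Finset.mem_image_of_mem _ ho)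
  have hQ : ∀ o ∈ O, ∀ τ : ℝ, |τ| ≤ δ₁ →
      a * |τ| ^ o ≤ |∑ q, Real.exp (e o q * τ) - ∑ q, Real.exp (f o q * τ)| ∧
      |∑ q, Real.exp (e o q * τ) - ∑ q, Real.exp (f o q * τ)| ≤ b * |τ| ^ o := by
    intro o ho τ hτ
    obtain ⟨h1, h2⟩ := hbound o ho τ (hτ.trans (hδ₁le o ho))
    have h0 : 0 ≤ |τ| ^ o := by positivity
    exact ⟨(mul_le_mul_of_nonneg_right (hale o ho) h0).trans h1,
      h2.trans (mul_le_mul_of_nonneg_right (hble' o ho) h0)⟩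
  set R : ℝ := min δ₁ 1 / 2 with hR
  have hRpos : 0 < R := by positivity
  have hR1 : 2 * R ≤ δ₁ := by rw [hR]; linarith [min_le_left δ₁ 1]
  have hR2 : 2 * R ≤ 1 := by rw [hR]; linarith [min_le_right δ₁ 1]
  set q := O.card with hq
  have hqk : q ≤ k := by simpa using Finset.card_le_card hOk
  have hqκ : q * Fintype.card (Fin k × Fin k) ≤ h := by
    simp only [Fintype.card_prod, Fintype.card_fin]
    calc q * (k * k) ≤ k * (k * k) := Nat.mul_le_mul_right _ hqk
      _ = k ^ 3 := by ring
      _ ≤ h := hk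
  have hqh : q ≤ h := by
    rcases Nat.eq_zero_or_pos k with h0 | h0
    · omega
    · exact (hqk.trans (Nat.le_self_pow (by norm_num) k)).trans hk
  -- `G` supplies the digit gap in the concentrated case, `G₁ * R > q` the lacunarity in the spread
  -- case. Neither depends on `A`, so `X₀` can absorb both.
  obtain ⟨G, hG⟩ := exists_nat_gt (q * (b * 3) * 6 / a + 1)
  obtain ⟨G₁, hG₁⟩ := exists_nat_gt ((q : ℝ) / R + 1)
  set c : ℝ := (5 * 16 ^ 5) ^ (N + 2) with hc
  refine ⟨q, N, max (max 16 c) (max (G + 1) (4 * (G₁ + 1) * q + 1)), hkO, ?_⟩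
  intro x hx A δ hxA hδ hδx hAA
  have hx16 : 16 ≤ x := ((le_max_left _ _).trans (le_max_left _ _)).trans hx
  have hxc : c ≤ x := ((le_max_right _ _).trans (le_max_left _ _)).trans hx
  have hxG : (G : ℝ) + 1 ≤ x := ((le_max_left _ _).trans (le_max_right _ _)).trans hx
  have hxG₁ : 4 * ((G₁ : ℝ) + 1) * q + 1 ≤ x := ((le_max_right _ _).trans (le_max_right _ _)).trans hx
  have hx0 : 0 < x := by linarith
  have hx1 : 1 ≤ x := by linarith
  have hδ0 : 0 < δ := by linarith
  have hA2 : 2 ≤ A.card := by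
    have h1 : x ≤ x ^ 100 := le_self_pow₀ hx1 (by norm_num)
    have h2 : (2 : ℝ) ≤ A.card := by rw [← hxA]; linarith
    exact_mod_cast h2
  obtain ⟨L, y, hy, hLL, hAL, hLA⟩ := exists_log_set hA2
  have hApos : (0 : ℝ) < A.card := by exact_mod_cast (show 0 < A.card by omega)
  have hALδ : (A.card : ℝ) ≤ 16 * L.card * δ := by
    have h1 : (A.card : ℝ) ^ 2 ≤ 16 * (L.card * (A * A).card) := by exact_mod_cast hAL
    have h2 : (A.card : ℝ) * A.card ≤ (16 * L.card * δ) * A.card := by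
      calc (A.card : ℝ) * A.card = (A.card : ℝ) ^ 2 := by ring
        _ ≤ _ := h1
        _ ≤ 16 * (L.card * (A.card * δ)) := by gcongr
        _ = _ := by ring
    exact le_of_mul_le_mul_right h2 hApos
  set K : ℝ := 16 * δ ^ 2 with hK
  have hK1 : 1 ≤ K := by
    have : 1 ≤ δ ^ 2 := one_le_pow₀ hδ
    rw [hK]; linarith
  have hLK : ((L + L).card : ℝ) ≤ K * L.card := by
    calc ((L + L).card : ℝ) ≤ (A * A).card := by exact_mod_cast hLL
      _ ≤ A.card * δ := hAA
      _ ≤ (16 * L.card * δ) * δ := by gcongr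
      _ = K * L.card := by rw [hK]; ring
  have hD : (5 * K ^ 5) ^ (N + 2) ≤ x * x := by
    calc (5 * K ^ 5) ^ (N + 2) = c * δ ^ (10 * (N + 2)) := by
          rw [hK, hc, pow_mul, ← mul_pow]; ring
      _ ≤ x * x := by gcongr
  have hδle : δ ≤ x := (le_self_pow₀ hδ (by omega)).trans hδx
  set s : ℝ := Real.sqrt (Real.sqrt L.card) with hs
  have hs4 : s ^ 4 = L.card := by
    calc s ^ 4 = (s ^ 2) ^ 2 := by ring
      _ = (L.card : ℝ) := by rw [hs, Real.sq_sqrt (Real.sqrt_nonneg _), Real.sq_sqrt (by positivity)]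
  have hs0 : 0 ≤ s := Real.sqrt_nonneg _
  have hsx : x ^ 24 ≤ s := by
    refine le_of_pow_le_pow_left₀ (n := 4) (by norm_num) hs0 ?_
    rw [hs4, ← pow_mul]
    have h1 : x ^ 98 * (x * x) ≤ L.card * (x * x) := by
      calc x ^ 98 * (x * x) = x ^ 100 := by ring
        _ = (A.card : ℝ) := hxA
        _ ≤ 16 * L.card * δ := hALδ
        _ ≤ x * L.card * x := by gcongr
        _ = _ := by ring
    exact (pow_le_pow_right₀ hx1 (by norm_num)).trans (le_of_mul_le_mul_right h1 (by positivity))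
  have hs1 : 1 < s := by
    have : x ≤ x ^ 24 := le_self_pow₀ hx1 (by norm_num)
    linarith
  have hLne : L.Nonempty := by
    rw [← Finset.card_pos]
    have : (0 : ℝ) < L.card := by rw [← hs4]; positivity
    exact_mod_cast this
  have hSne : (A * A).Nonempty := by
    obtain ⟨l, hl⟩ := hLne
    exact ⟨_, hLA _ (Finset.sub_mem_sub hl hl)⟩
  rcases lt_or_ge ((numCells R L : ℕ) : ℝ) s with hcells | hcells
  · obtain ⟨τ, Y, hτ0, hτ, hYcard, hprog, hdiam, hsep⟩ := exists_separated_progressions (G := G + 1)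
      N (Nat.succ_pos G) hK1 hLK hRpos hs1 hs4 hcells (by
        calc 4 * (5 * K ^ 5) ^ N ≤ 4 * (5 * K ^ 5) ^ (N + 2) := by
              gcongr
              · have : 1 ≤ K ^ 5 := one_le_pow₀ hK1
                linarith
              · omega
          _ ≤ x * (x * x) := by gcongr; linarith
          _ = x ^ 3 := by ring
          _ ≤ x ^ 48 := pow_le_pow_right₀ hx1 (by norm_num)
          _ = (x ^ 24) ^ 2 := by rw [← pow_mul]
          _ ≤ s ^ 2 := by gcongr)
    have hYx : x ^ 20 ≤ Y.card := by
      have h1 : x ^ 20 * x ^ 3 ≤ Y.card * x ^ 3 := by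
        calc x ^ 20 * x ^ 3 = x ^ 23 := by ring
          _ ≤ x ^ 24 := pow_le_pow_right₀ hx1 (by norm_num)
          _ ≤ s := hsx
          _ ≤ (5 * K ^ 5) ^ (N + 2) * (G + 1 : ℕ) * Y.card := hYcard
          _ ≤ (x * x) * x * Y.card := by
            push_cast
            gcongr
          _ = _ := by ring
      exact le_of_mul_le_mul_right h1 (by positivity)
    have hYne : Y.Nonempty := by
      rw [← Finset.card_pos]
      have : (0 : ℝ) < Y.card := lt_of_lt_of_le (by positivity) hYx
      exact_mod_cast this
    have hfin := card_pow_le_sq_card_hFoldSumset (h := h) (N := N) (G := G + 1) (O := O) (e := e)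
      (f := f) (a := a) (b := b) (τ := τ) hqκ hSne hYne he hf hy
      (fun u hu i hi => hLA _ (hprog u hu i (by omega))) hτ0 (by linarith) ha
      (fun o ho => hQ o ho τ (by linarith)) (fun u hu v hv => by linarith [hdiam u hu v hv]) hsep (by
        have h1 : q * (b * 3) * 6 / a < G := by linarith
        rw [div_lt_iff₀ ha] at h1
        push_cast
        rw [← hq]
        linarith)
    have hfin' : ((Y.card : ℝ)) ^ q ≤ ((hFoldSumset h (A * A)).card : ℝ) ^ 2 := by
      exact_mod_cast hfin
    refine le_of_pow_le_pow_left₀ (n := 2) (by norm_num) (by positivity) ?_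
    calc (x ^ (10 * q)) ^ 2 = (x ^ 20) ^ q := by rw [← pow_mul, ← pow_mul]; ring_nf
      _ ≤ (Y.card : ℝ) ^ q := by gcongr
      _ ≤ _ := hfin'
  -- `L` occupies at most two cells of length `R'`, so separating it costs only the factor `2 * (G₁
  -- + 1)`.
  · obtain ⟨R', hR', hR'2⟩ := exists_numCells_le_two L
    obtain ⟨Y, hYL, hYcard, -, hYsep⟩ :=
      exists_separated_subset (X := L) hRpos hR' (Nat.succ_pos G₁)
    obtain ⟨l, hl⟩ := hLne
    have hYx : 2 * q * x ^ 10 ≤ Y.card ∧ (2 * q : ℝ) ≤ Y.card := by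
      have h1 : (numCells R L : ℝ) ≤ 2 * (G₁ + 1) * Y.card := by
        have : numCells R L ≤ 2 * (G₁ + 1) * Y.card :=
          hYcard.trans (Nat.mul_le_mul_right _ (Nat.mul_le_mul_right _ hR'2))
        exact_mod_cast this
      have h2 : x * x ^ 10 ≤ 2 * (G₁ + 1) * Y.card := by
        calc x * x ^ 10 = x ^ 11 := by ring
          _ ≤ x ^ 24 := pow_le_pow_right₀ hx1 (by norm_num)
          _ ≤ _ := (hsx.trans hcells).trans h1
      have h3 : (2 * ((G₁ : ℝ) + 1)) * (2 * q * x ^ 10) ≤ 2 * (G₁ + 1) * Y.card := by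
        calc (2 * ((G₁ : ℝ) + 1)) * (2 * q * x ^ 10) = (4 * (G₁ + 1) * q) * x ^ 10 := by ring
          _ ≤ x * x ^ 10 := by gcongr; linarith
          _ ≤ _ := h2
      have h4 := le_of_mul_le_mul_left h3 (by positivity)
      refine ⟨h4, le_trans ?_ h4⟩
      exact le_mul_of_one_le_right (by positivity) (one_le_pow₀ hx1)
    -- Here `Y ⊆ L` rather than `L - L`; the translation by a fixed `l ∈ L` goes into the dilation
    -- factor.
    have hchoose := choose_le_card_hFoldSumset (h := h) (q := q) (S := A * A) (Y := Y)
      (y := y * Real.exp (-l)) hqh hSne (mul_ne_zero hy (Real.exp_pos _).ne') (by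
        intro u hu
        have := hLA _ (Finset.sub_mem_sub (hYL hu) hl)
        rw [sub_eq_neg_add, Real.exp_add, ← mul_assoc] at this
        exact this) (by
        intro u hu v hv hvu
        have h1 := hYsep u hu v hv hvu.ne'
        rw [abs_of_pos (sub_pos.2 hvu)] at h1
        refine le_trans ?_ h1.le
        push_cast
        have h2 : (q : ℝ) / R < G₁ := by linarith
        rw [div_lt_iff₀ hRpos] at h2
        linarith)
    have hpow := pow_le_pow_mul_choose (n := Y.card) (q := q) (by exact_mod_cast hYx.2)
    rcases Nat.eq_zero_or_pos q with h0 | hqpos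
    · rw [h0] at hchoose ⊢
      simp only [Nat.choose_zero_right] at hchoose
      simpa using hchoose
    have h5 : (2 * q : ℝ) ^ q * x ^ (10 * q) ≤ (2 * q : ℝ) ^ q * (hFoldSumset h (A * A)).card := by
      calc (2 * q : ℝ) ^ q * x ^ (10 * q) = (2 * q * x ^ 10) ^ q := by
            rw [mul_pow (2 * q : ℝ), ← pow_mul]
        _ ≤ (Y.card : ℝ) ^ q := by gcongr; exact hYx.1
        _ ≤ (2 * q : ℝ) ^ q * Y.card.choose q := by exact_mod_cast hpow
        _ ≤ _ := by gcongr
    exact le_of_mul_le_mul_left h5 (by positivity)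

/-! ### Choice of parameters -/

theorem exists_cube_le_lt (h : ℕ) : ∃ k : ℕ, k ^ 3 ≤ h ∧ h < (k + 1) ^ 3 := by
  induction h with
  | zero => exact ⟨0, by norm_num, by norm_num⟩
  | succ h ih =>
    obtain ⟨k, h1, h2⟩ := ih
    rcases Nat.lt_or_ge (h + 1) ((k + 1) ^ 3) with h3 | h3
    · exact ⟨k, by omega, h3⟩
    · refine ⟨k + 1, h3, ?_⟩
      have : (k + 1) ^ 3 < (k + 1 + 1) ^ 3 := Nat.pow_lt_pow_left (by omega) (by norm_num)
      omega

/-- The logarithm is discarded through `log h ≥ 1/2`. -/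
theorem rpow_div_log_le {h k : ℕ} (hh : 2 ≤ h) (hk : h < (k + 1) ^ 3) :
    ((h : ℝ) / Real.log h) ^ ((1 : ℝ) / 3) ≤ 2 * (k + 1) := by
  have hlog : 1 / 2 ≤ Real.log h := by
    have h1 : Real.log 2 ≤ Real.log h := Real.log_le_log (by norm_num) (by exact_mod_cast hh)
    linarith [Real.log_two_gt_d9]
  have h1 : (h : ℝ) / Real.log h ≤ (2 * (k + 1)) ^ 3 := by
    rw [div_le_iff₀ (by linarith)]
    have h2 : (h : ℝ) ≤ (k + 1) ^ 3 := by exact_mod_cast hk.le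
    calc (h : ℝ) ≤ (k + 1) ^ 3 * 1 := by linarith
      _ ≤ (k + 1) ^ 3 * (8 * Real.log h) := by gcongr; linarith
      _ = _ := by ring
  calc _ ≤ ((2 * ((k : ℝ) + 1)) ^ 3) ^ ((1 : ℝ) / 3) :=
        Real.rpow_le_rpow (div_nonneg (by positivity) (by linarith)) h1 (by norm_num)
    _ = 2 * (k + 1) := by
      rw [← Real.rpow_natCast, ← Real.rpow_mul (by positivity)]
      norm_num

theorem card_le_card_mul_self {A : Finset ℝ} (hA : 2 ≤ A.card) : A.card ≤ (A * A).card := by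
  classical
  obtain ⟨a, ha, ha0⟩ : ∃ a ∈ A, a ≠ 0 := by
    obtain ⟨a, ha, b, hb, hab⟩ := Finset.one_lt_card.1 hA
    by_cases h : a = 0
    · exact ⟨b, hb, fun h' => hab (h.trans h'.symm)⟩
    · exact ⟨a, ha, h⟩
  exact Finset.card_le_card_of_injOn (fun b => a * b)
    (fun b hb => Finset.mem_coe.2 (Finset.mul_mem_mul ha hb))
    fun b _ b' _ h => mul_left_cancel₀ ha0 h

theorem theorem2 :
    ∃ c : ℝ, 0 < c ∧
      ∀ h : ℕ, 2 ≤ h →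
        ∃ ε₀ : ℝ, 0 < ε₀ ∧
          ∀ ε : ℝ, 0 < ε → ε < ε₀ →
            ∃ n₀ : ℕ, ∀ n : ℕ, n₀ < n →
              ∀ A : Finset ℝ, A.card = n →
                ((A * A).card : ℝ) ≤ (n : ℝ) ^ (1 + ε) →
                  (n : ℝ) ^ (c * ((h : ℝ) / Real.log (h : ℝ)) ^ ((1 : ℝ) / 3)) <
                    ((hFoldSumset h (A * A)).card : ℝ) := by
  refine ⟨1 / 1000, by norm_num, fun h hh => ?_⟩
  obtain ⟨k, hk1, hk2⟩ := exists_cube_le_lt h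
  have hexp := rpow_div_log_le hh hk2
  rcases Nat.lt_or_ge k 2 with hk | hk
  -- Here `h < 8` and the exponent is at most `4 / 1000`, so the trivial bound `|A| ≤ |h(A.A)|`
  -- suffices.
  · refine ⟨1, one_pos, fun ε _ _ => ⟨1, fun n hn A hA _ => ?_⟩⟩
    have hk' : (k : ℝ) ≤ 1 := by exact_mod_cast Nat.lt_succ_iff.1 hk
    calc (n : ℝ) ^ (1 / 1000 * ((h : ℝ) / Real.log (h : ℝ)) ^ ((1 : ℝ) / 3)) < (n : ℝ) ^ (1 : ℝ) :=
          Real.rpow_lt_rpow_of_exponent_lt (by exact_mod_cast hn) (by linarith)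
      _ = (A.card : ℝ) := by rw [Real.rpow_one, hA]
      _ ≤ _ := by
        exact_mod_cast (card_le_card_mul_self (by omega)).trans
          (card_le_card_hFoldSumset (by omega))
  · obtain ⟨q, M, X₀, hkq, hmain⟩ := exists_pow_le_card_hFoldSumset hk1
    -- With `x = n ^ (1/100)` and `δ = n ^ ε`, the condition `δ ^ (10 * (M + 2)) ≤ x` reads `1000 *
    -- (M + 2) * ε ≤ 1`.
    refine ⟨1 / (1000 * (M + 2)), by positivity, fun ε hε hε₀ =>
      ⟨max 1 ⌈(max X₀ 0) ^ 100⌉₊, fun n hn A hA hAA => ?_⟩⟩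
    have hn1 : (1 : ℝ) < n := by exact_mod_cast (le_max_left _ _).trans_lt hn
    have hn0 : (0 : ℝ) < n := by linarith
    have hnX : (max X₀ 0) ^ 100 ≤ (n : ℝ) :=
      (Nat.le_ceil _).trans (by exact_mod_cast ((le_max_right _ _).trans_lt hn).le)
    have hx100 : ((n : ℝ) ^ ((1 : ℝ) / 100)) ^ 100 = n := by
      rw [← Real.rpow_natCast, ← Real.rpow_mul hn0.le]
      norm_num
    have hX₀ : X₀ ≤ (n : ℝ) ^ ((1 : ℝ) / 100) := by
      refine (le_max_left X₀ 0).trans (le_of_pow_le_pow_left₀ (n := 100) (by norm_num)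
        (by positivity) ?_)
      rw [hx100]; exact hnX
    have key := hmain _ hX₀ A ((n : ℝ) ^ ε) (by rw [hx100, hA])
      (Real.one_le_rpow hn1.le hε.le) (by
        rw [← Real.rpow_natCast, ← Real.rpow_mul hn0.le]
        refine Real.rpow_le_rpow_of_exponent_le hn1.le ?_
        rw [lt_div_iff₀ (by positivity)] at hε₀
        push_cast
        linarith) (by
        rw [hA]
        refine hAA.trans (le_of_eq ?_)
        rw [Real.rpow_add hn0, Real.rpow_one])
    refine lt_of_lt_of_le ?_ key
    rw [← Real.rpow_natCast, ← Real.rpow_mul hn0.le]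
    -- The required exponent is at most `(k + 1) / 500`, the one obtained is `q / 10 ≥ (k - 1) /
    -- 60`, which is larger once `k ≥ 2`.
    refine Real.rpow_lt_rpow_of_exponent_lt hn1 ?_
    have h1 : (k : ℝ) ≤ 6 * q + 1 := by exact_mod_cast hkq
    have h2 : (2 : ℝ) ≤ k := by exact_mod_cast hk
    push_cast
    linarith
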